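/- There exist absolute constants $N\in\mathbb{N}$ and $c>0$ such that the following holds. Let $p$ be a prime and let $A\subseteq \mathrm{SL}_2(\mathbb{F}_p)$ be a symmetric set (that is, $A^{-1}=A$, where $A^{-1}=\{a^{-1}: a\in A\}$) that generates the group $\mathrm{SL}_2(\mathbb{F}_p)$. Write $A^3=\{a_1a_2a_3 : a_1,a_2,a_3\in A\}$, and let $K$ be the real number with $|A^3|=K|A|$. If $|A|>N$, then either $A^3=\mathrm{SL}_2(\mathbb{F}_p)$ or $K\ge c\,|A|^{1/20}$. -/

import Mathlib

open scoped Pointwise MatrixGroups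

/-! Write `G` for the group and `a` for the size of `A`. It is enough to show that `a` is at most `2
^ 77 * K ^ 19` when `A ^ 3` is not `G`. Small tripling bounds the size of `A ^ m` by `K ^ (m - 2) *
a` for `m ≥ 3`, so inequalities between the sizes of bounded powers of `A` become bounds for `a`.

Small sets grow because of tori. Call an element regular if its trace squared is not 4. Its
conjugacy class is two-dimensional in a three-dimensional group, so a regular `v` in `A ^ 2` should
have about `a ^ (2/3)` conjugates by `A` at most. `card_conj_cube_le` proves this by sending triples
of conjugates to pairs of quotients: for triples in general position (`hasManyTriples`), a fibre
lies where an affine line meets the quadric `det = 1`, so it has at most two points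
(`card_triples_le`). By orbit-stabilizer, `A ^ 2` then meets the centralizer of `v` in at least
about `a ^ (1/3)` elements.

Pivoting (`growth_alternative`) compares a torus with its conjugates. If some torus meets `A ^ 2`
outside `±1` while its conjugate by an element of `A` does not, then the products `b * a * v` with
`v` in the first torus are distinct up to sign, so `A ^ 4` has size at least about `a ^ (4/3)`.
Otherwise every conjugate torus is met, and counting over all conjugates forces `p ^ 3` to be at
most `a` times a power of `K`.

Large sets are handled by quasirandomness. Representations without invariant vectors have dimension
at least `(p - 1) / 2` (`sub_one_le_two_mul_finrank`), so convolution with the balanced indicator of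
`A` has small norm. Hence either `a` is at most about `K * p ^ 2`, which together with the previous
bound finishes, or `A ^ 2` fills half of `G`; in the latter case `A ^ 3 ≠ G` bounds `p`, and so `a`,
by a power of `K`. -/

/-- The binary quadratic form `det (a, x a)`, whose zeros are the eigenvectors of `x`. -/
def eigenForm {F : Type*} [Field F] (x : Matrix (Fin 2) (Fin 2) F) (a : F × F) : F :=
  x 1 0 * a.1 ^ 2 + (x 1 1 - x 0 0) * a.1 * a.2 - x 0 1 * a.2 ^ 2

/-! ### Eigenlines of two-by-two matrices through binary quadratic forms. -/

section LinearAlgebra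

variable {F : Type*} [Field F]

lemma SL2_det_eq (x : SL(2, F)) : x 0 0 * x 1 1 - x 0 1 * x 1 0 = 1 := by
  have := x.2
  rwa [Matrix.det_fin_two] at this

lemma SL2_inv_apply (x : SL(2, F)) :
    (x⁻¹ : SL(2, F)) 0 0 = x 1 1 ∧ (x⁻¹ : SL(2, F)) 0 1 = - x 0 1 ∧
    (x⁻¹ : SL(2, F)) 1 0 = - x 1 0 ∧ (x⁻¹ : SL(2, F)) 1 1 = x 0 0 := by
  rw [Matrix.SpecialLinearGroup.SL2_inv_expl]
  simp

lemma SL2_mul_apply (x y : SL(2, F)) (i j : Fin 2) :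
    (x * y) i j = x i 0 * y 0 j + x i 1 * y 1 j := by
  rw [Matrix.SpecialLinearGroup.coe_mul, Matrix.mul_apply, Fin.sum_univ_two]

lemma SL2_ext {x y : SL(2, F)} (h₁ : x 0 0 = y 0 0) (h₂ : x 0 1 = y 0 1)
    (h₃ : x 1 0 = y 1 0) (h₄ : x 1 1 = y 1 1) : x = y := by
  ext i j
  fin_cases i <;> fin_cases j <;> assumption

lemma trace_conj (u x : SL(2, F)) :
    (u * x * u⁻¹ : SL(2, F)).1.trace = x.1.trace := by
  rw [Matrix.SpecialLinearGroup.coe_mul, Matrix.trace_mul_comm,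
    ← Matrix.SpecialLinearGroup.coe_mul]
  simp

lemma eigenForm_add (x y : Matrix (Fin 2) (Fin 2) F) (a : F × F) :
    eigenForm (x + y) a = eigenForm x a + eigenForm y a := by
  simp only [eigenForm, Matrix.add_apply]; ring

lemma eigenForm_smul (c : F) (x : Matrix (Fin 2) (Fin 2) F) (a : F × F) :
    eigenForm (c • x) a = c * eigenForm x a := by
  simp only [eigenForm, Matrix.smul_apply, smul_eq_mul]; ring

/-- The action of `SL(2, F)` on the plane. -/
def planeAct (u : SL(2, F)) (a : F × F) : F × F :=
  (u 0 0 * a.1 + u 0 1 * a.2, u 1 0 * a.1 + u 1 1 * a.2)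

lemma planeAct_mul (u v : SL(2, F)) (a : F × F) :
    planeAct (u * v) a = planeAct u (planeAct v a) := by
  simp only [planeAct, SL2_mul_apply, Prod.mk.injEq]
  constructor <;> ring

lemma planeAct_one (a : F × F) : planeAct 1 a = a := by
  simp [planeAct]

lemma eigenForm_conj (u x : SL(2, F)) (a : F × F) :
    eigenForm (u * x * u⁻¹ : SL(2, F)).1 (planeAct u a) = eigenForm x.1 a := by
  obtain ⟨h1, h2, h3, h4⟩ := SL2_inv_apply u
  have hu := SL2_det_eq u
  simp only [eigenForm, planeAct, SL2_mul_apply, h1, h2, h3, h4]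
  have h3' : u 0 0 * u 1 1 - u 0 1 * u 1 0 = 1 := hu
  generalize u 0 0 = p at *
  generalize u 0 1 = q at *
  generalize u 1 0 = r at *
  generalize u 1 1 = s at *
  generalize x 0 0 = x0 at *
  generalize x 0 1 = x1 at *
  generalize x 1 0 = x2 at *
  generalize x 1 1 = x3 at *
  have : (p * s - q * r) ^ 2 = 1 := by rw [h3']; ring
  linear_combination (x2 * a.1 ^ 2 + (x3 - x0) * a.1 * a.2 - x1 * a.2 ^ 2) * this

/-- The cross product of two vectors of the plane. -/
def cross (a b : F × F) : F := a.1 * b.2 - a.2 * b.1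

lemma cross_planeAct (u : SL(2, F)) (a b : F × F) :
    cross (planeAct u a) (planeAct u b) = cross a b := by
  have hu := SL2_det_eq u
  simp only [cross, planeAct]
  linear_combination (a.1 * b.2 - a.2 * b.1) * hu

lemma exists_smul_of_cross_eq_zero {a b : F × F} (ha : a ≠ 0) (h : cross a b = 0) :
    ∃ t : F, b = t • a := by
  obtain ⟨a1, a2⟩ := a
  obtain ⟨b1, b2⟩ := b
  simp only [cross] at h
  by_cases h1 : a1 = 0
  · have h2 : a2 ≠ 0 := by
      rintro rfl; exact ha (by simp [h1])
    refine ⟨b2 / a2, ?_⟩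
    subst h1
    have : b1 = 0 := by simpa [h2] using h
    simp [this, h2]
  · refine ⟨b1 / a1, ?_⟩
    simp only [Prod.smul_mk, smul_eq_mul, Prod.mk.injEq]
    constructor
    · field_simp
    · field_simp; linear_combination h

lemma eigenForm_smul_right (x : Matrix (Fin 2) (Fin 2) F) (t : F) (a : F × F) :
    eigenForm x (t • a) = t ^ 2 * eigenForm x a := by
  simp only [eigenForm, Prod.smul_fst, Prod.smul_snd, smul_eq_mul]; ring

lemma eigenForm_eq_zero_of_cross {x : Matrix (Fin 2) (Fin 2) F} {a b : F × F} (ha : a ≠ 0)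
    (h : cross a b = 0) (hx : eigenForm x a = 0) : eigenForm x b = 0 := by
  obtain ⟨t, rfl⟩ := exists_smul_of_cross_eq_zero ha h
  rw [eigenForm_smul_right, hx, mul_zero]

/-- The polar form of `eigenForm x`. -/
def eigenPolar (x : Matrix (Fin 2) (Fin 2) F) (a b : F × F) : F :=
  2 * x 1 0 * a.1 * b.1 + (x 1 1 - x 0 0) * (a.1 * b.2 + a.2 * b.1) - 2 * x 0 1 * a.2 * b.2

/-- Cramer's rule writes `cross a b • d` as `cross d b • a + cross a d • b`; the form is then
expanded by polarity. -/
lemma cross_sq_mul_eigenForm (x : Matrix (Fin 2) (Fin 2) F) (a b d : F × F) :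
    cross a b ^ 2 * eigenForm x d = cross d b ^ 2 * eigenForm x a +
      cross d b * cross a d * eigenPolar x a b + cross a d ^ 2 * eigenForm x b := by
  simp only [cross, eigenForm, eigenPolar]; ring

/-- The discriminant of the eigenvector form is that of the characteristic polynomial, and a change
of basis multiplies it by the squared determinant. This is how the trace enters all counts of
eigenlines. -/
lemma eigenPolar_sq (x : SL(2, F)) (a b : F × F) :
    eigenPolar x.1 a b ^ 2 - 4 * eigenForm x.1 a * eigenForm x.1 b =
      cross a b ^ 2 * (x.1.trace ^ 2 - 4) := by
  have hx := SL2_det_eq x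
  rw [Matrix.trace_fin_two]
  simp only [cross, eigenForm, eigenPolar]
  linear_combination -4 * (a.1 * b.2 - a.2 * b.1) ^ 2 * hx

lemma exists_eigenlines {x : SL(2, F)} (hx : x.1.trace ^ 2 ≠ 4) :
    ∃ e₁ e₂ : F × F, e₁ ≠ 0 ∧ e₂ ≠ 0 ∧
      ∀ a, a ≠ 0 → eigenForm x.1 a = 0 → cross e₁ a = 0 ∨ cross e₂ a = 0 := by
  by_cases h1 : ∃ e₁, e₁ ≠ 0 ∧ eigenForm x.1 e₁ = 0
  · obtain ⟨e₁, he₁, hf₁⟩ := h1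
    by_cases h2 : ∃ e₂, e₂ ≠ 0 ∧ eigenForm x.1 e₂ = 0 ∧ cross e₁ e₂ ≠ 0
    · obtain ⟨e₂, he₂, hf₂, hc⟩ := h2
      refine ⟨e₁, e₂, he₁, he₂, fun a ha hfa => ?_⟩
      have k1 := cross_sq_mul_eigenForm x.1 e₁ e₂ a
      have k2 := eigenPolar_sq x e₁ e₂
      rw [hf₁, hf₂] at k1
      rw [hf₁] at k2
      have hne : eigenPolar x.1 e₁ e₂ ≠ 0 := by
        intro h0
        rw [h0] at k2
        have : cross e₁ e₂ ^ 2 * (x.1.trace ^ 2 - 4) ≠ 0 :=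
          mul_ne_zero (pow_ne_zero _ hc) (sub_ne_zero.2 hx)
        apply this; rw [← k2]; ring
      rw [hfa] at k1
      have k3 : cross a e₂ * cross e₁ a * eigenPolar x.1 e₁ e₂ = 0 := by
        linear_combination -k1
      rcases mul_eq_zero.1 k3 with h | h
      · rcases mul_eq_zero.1 h with h | h
        · right
          simp only [cross] at h ⊢
          linear_combination -h
        · exact Or.inl h
      · exact absurd h hne
    · push Not at h2
      exact ⟨e₁, e₁, he₁, he₁, fun a ha hfa => Or.inl (h2 a ha hfa)⟩
  · push Not at h1
    exact ⟨(1, 0), (1, 0), by simp, by simp, fun a ha hfa => absurd hfa (h1 a ha)⟩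

/-- With both eigenlines fixed, the form is a multiple of one product of coordinates, and the trace
fixes that multiple up to sign. Form and trace determine the matrix when 2 is invertible, and
changing the sign of the form amounts to inversion. -/
lemma eq_or_eq_inv_of_common_eigenlines (h2 : (2 : F) ≠ 0) {x y : SL(2, F)}
    (ht : y.1.trace = x.1.trace) {a b : F × F} (hab : cross a b ≠ 0)
    (hxa : eigenForm x.1 a = 0) (hxb : eigenForm x.1 b = 0)
    (hya : eigenForm y.1 a = 0) (hyb : eigenForm y.1 b = 0) : y = x ∨ y = x⁻¹ := by
  have kx := eigenPolar_sq x a b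
  have ky := eigenPolar_sq y a b
  rw [hxa] at kx
  rw [hya, ht] at ky
  have hsq : eigenPolar y.1 a b ^ 2 = eigenPolar x.1 a b ^ 2 := by linear_combination ky - kx
  have hc2 : cross a b ^ 2 ≠ 0 := pow_ne_zero _ hab
  rw [Matrix.trace_fin_two, Matrix.trace_fin_two] at ht
  have hform : ∀ s : F, eigenPolar y.1 a b = s * eigenPolar x.1 a b →
      ∀ d, eigenForm y.1 d = s * eigenForm x.1 d := by
    intro s hs d
    have k1 := cross_sq_mul_eigenForm x.1 a b d
    have k2 := cross_sq_mul_eigenForm y.1 a b d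
    rw [hxa, hxb] at k1
    rw [hya, hyb, hs] at k2
    apply mul_left_cancel₀ hc2
    linear_combination k2 - s * k1
  rcases sq_eq_sq_iff_eq_or_eq_neg.1 hsq with h | h
  · left
    have hf := hform 1 (by rw [h, one_mul])
    have f1 := hf (1, 0)
    have f2 := hf (0, 1)
    have f3 := hf (1, 1)
    simp only [eigenForm] at f1 f2 f3
    refine SL2_ext (mul_left_cancel₀ h2 ?_) ?_ ?_ (mul_left_cancel₀ h2 ?_)
    · linear_combination ht - f3 + f1 + f2
    · linear_combination -f2
    · linear_combination f1
    · linear_combination ht + f3 - f1 - f2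
  · right
    have hf := hform (-1) (by rw [h, neg_one_mul])
    have f1 := hf (1, 0)
    have f2 := hf (0, 1)
    have f3 := hf (1, 1)
    simp only [eigenForm] at f1 f2 f3
    obtain ⟨i1, i2, i3, i4⟩ := SL2_inv_apply x
    refine SL2_ext (mul_left_cancel₀ h2 ?_) ?_ ?_ (mul_left_cancel₀ h2 ?_)
    · rw [i1]; linear_combination ht - f3 + f1 + f2
    · rw [i2]; linear_combination -f2
    · rw [i3]; linear_combination f1
    · rw [i4]; linear_combination ht + f3 - f1 - f2

lemma eq_or_eq_neg_of_mem_span (x y : SL(2, F)) (h : y.1 ∈ Submodule.span F {x.1}) :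
    y = x ∨ y = -x := by
  obtain ⟨c, hc⟩ := Submodule.mem_span_singleton.1 h
  have h1 := x.2
  have h2 := y.2
  rw [← hc, Matrix.det_smul, h1] at h2
  simp only [Fintype.card_fin, mul_one] at h2
  have h3 : (c - 1) * (c + 1) = 0 := by linear_combination h2
  rcases mul_eq_zero.1 h3 with h | h
  · left
    apply Subtype.ext
    rw [← hc, sub_eq_zero.1 h, one_smul]
  · right
    apply Subtype.ext
    rw [← hc, eq_neg_of_add_eq_zero_left h, neg_one_smul]
    rfl

end LinearAlgebra

/-! ### General position, and subspaces moved by a generating set. -/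

section General

variable {F : Type*} [Field F]

/-- The trace pairing is nondegenerate, so the annihilator of a three-dimensional space of matrices
is a line. -/
lemma exists_smul_of_trace_mul_eq_zero {x y z v w : Matrix (Fin 2) (Fin 2) F}
    (hxyz : LinearIndependent F ![x, y, z]) (hv : v ≠ 0)
    (hxv : (x * v).trace = 0) (hyv : (y * v).trace = 0) (hzv : (z * v).trace = 0)
    (hxw : (x * w).trace = 0) (hyw : (y * w).trace = 0) (hzw : (z * w).trace = 0) :
    ∃ t : F, w = t • v := by
  let φ : Matrix (Fin 2) (Fin 2) F → Module.Dual F (Matrix (Fin 2) (Fin 2) F) :=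
    fun v => (Matrix.traceLinearMap (Fin 2) F F) ∘ₗ (LinearMap.mulRight F v)
  have hφ : ∀ v m, φ v m = (m * v).trace := fun v m => rfl
  set W := Submodule.span F (Set.range ![x, y, z]) with hW
  have hWf : Module.finrank F W = 3 := by
    rw [hW, finrank_span_eq_card hxyz]; rfl
  have hmem : ∀ u, (x * u).trace = 0 → (y * u).trace = 0 → (z * u).trace = 0 →
      φ u ∈ W.dualAnnihilator := by
    intro u h1 h2 h3
    rw [Submodule.mem_dualAnnihilator]
    intro m hm
    have : W ≤ LinearMap.ker (φ u) := by
      rw [hW, Submodule.span_le]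
      rintro _ ⟨i, rfl⟩
      fin_cases i <;> simpa [hφ]
    exact this hm
  have hfin := Subspace.finrank_add_finrank_dualAnnihilator_eq W
  have hM : Module.finrank F (Matrix (Fin 2) (Fin 2) F) = 4 := by
    rw [Module.finrank_matrix]; simp
  have h1 : Module.finrank F W.dualAnnihilator = 1 := by omega
  have hv0 : φ v ≠ 0 := by
    intro h
    apply hv
    apply Matrix.ext_iff_trace_mul_left.2
    intro m
    rw [← hφ, h]; simp
  have hne : (⟨φ v, hmem v hxv hyv hzv⟩ : W.dualAnnihilator) ≠ 0 := by
    intro h; exact hv0 (congrArg Subtype.val h)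
  obtain ⟨t, ht⟩ := (finrank_eq_one_iff_of_nonzero'
    (⟨φ v, hmem v hxv hyv hzv⟩ : W.dualAnnihilator) hne).1 h1 ⟨φ w, hmem w hxw hyw hzw⟩
  refine ⟨t, ?_⟩
  apply Matrix.ext_iff_trace_mul_left.2
  intro m
  have := congrArg (fun f => (Subtype.val f) m) ht
  simp only [SetLike.val_smul, LinearMap.smul_apply, hφ] at this
  rw [Matrix.mul_smul, Matrix.trace_smul, this]

/-- Three matrices are in general position if they are linearly independent and have no common
eigenvector. -/
def GeneralPosition (x y z : Matrix (Fin 2) (Fin 2) F) : Prop :=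
  LinearIndependent F ![x, y, z] ∧
    ∀ a, a ≠ 0 → eigenForm x a = 0 → eigenForm y a = 0 → eigenForm z a = 0 → False

/-- A nonzero nilpotent `v` has rank one with image equal to its kernel, spanned by `a`; then `(x *
v).trace` is proportional to `det (a, x a)`. The two witnesses below span the kernel of `v`. -/
lemma exists_eigenvector_of_nilpotent {v : Matrix (Fin 2) (Fin 2) F} (hv : v ≠ 0)
    (ht : v 0 0 + v 1 1 = 0) (hd : v 0 0 * v 1 1 - v 0 1 * v 1 0 = 0) :
    ∃ a, a ≠ 0 ∧ ∀ x : Matrix (Fin 2) (Fin 2) F, (x * v).trace = 0 → eigenForm x a = 0 := by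
  have h11 : v 1 1 = - v 0 0 := by linear_combination ht
  rw [h11] at hd
  by_cases h : (v 0 1, - v 0 0) = ((0, 0) : F × F)
  · have h1 : v 0 1 = 0 := congrArg Prod.fst h
    have h2 : v 0 0 = 0 := neg_eq_zero.1 (congrArg Prod.snd h)
    have h3 : v 1 0 ≠ 0 := by
      intro h3
      apply hv
      ext i j
      fin_cases i <;> fin_cases j <;> simp [*]
    refine ⟨(0, 1), by simp, fun x hx => ?_⟩
    rw [Matrix.trace_fin_two, Matrix.mul_apply, Matrix.mul_apply, Fin.sum_univ_two,
      Fin.sum_univ_two, h11, h1, h2] at hx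
    have : x 0 1 = 0 := by simpa [h3] using hx
    simp [eigenForm, this]
  · refine ⟨_, h, fun x hx => ?_⟩
    rw [Matrix.trace_fin_two, Matrix.mul_apply, Matrix.mul_apply, Fin.sum_univ_two,
      Fin.sum_univ_two, h11] at hx
    simp only [eigenForm]
    linear_combination (v 0 1) * hx + x 0 1 * hd

/-- The trace conditions confine `η` and `ζ` to one affine line through 1. A line meets the quadric
`det = 1` in at most two points unless it lies inside it; its direction is then nilpotent, which
yields a common eigenvector. -/
lemma GeneralPosition.eq_of_trace_eq {x y z : Matrix (Fin 2) (Fin 2) F}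
    (h : GeneralPosition x y z) {η ζ : SL(2, F)} (hη : η ≠ 1) (hζ : ζ ≠ 1)
    (hxη : (x * η.1).trace = x.trace) (hyη : (y * η.1).trace = y.trace)
    (hzη : (z * η.1).trace = z.trace)
    (hxζ : (x * ζ.1).trace = x.trace) (hyζ : (y * ζ.1).trace = y.trace)
    (hzζ : (z * ζ.1).trace = z.trace) : η = ζ := by
  have key : ∀ (m : Matrix (Fin 2) (Fin 2) F) (θ : SL(2, F)), (m * θ.1).trace = m.trace →
      (m * (θ.1 - 1)).trace = 0 := by
    intro m θ hm
    rw [mul_sub, Matrix.trace_sub, hm, mul_one, sub_self]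
  have hne : ∀ θ : SL(2, F), θ ≠ 1 → θ.1 - 1 ≠ 0 := by
    intro θ hθ h0
    exact hθ (Subtype.ext (sub_eq_zero.1 h0))
  obtain ⟨t, ht⟩ := exists_smul_of_trace_mul_eq_zero h.1 (hne η hη) (key _ _ hxη) (key _ _ hyη)
    (key _ _ hzη) (key _ _ hxζ) (key _ _ hyζ) (key _ _ hzζ)
  have hdη := SL2_det_eq η
  have hdζ := SL2_det_eq ζ
  set v := η.1 - 1 with hv
  have e1 : η.1 = 1 + v := by rw [hv]; abel
  have e2 : ζ.1 = 1 + t • v := by rw [← ht]; abel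
  have ht0 : t ≠ 0 := by
    rintro rfl
    apply hne ζ hζ
    rw [ht, zero_smul]
  rw [e1] at hdη
  rw [e2] at hdζ
  simp only [Matrix.add_apply, Matrix.smul_apply, Matrix.one_apply_eq, smul_eq_mul, ne_eq,
    zero_ne_one, one_ne_zero, not_false_eq_true, Matrix.one_apply_ne, zero_add] at hdη hdζ
  have h1 : (v 0 0 + v 1 1) + (v 0 0 * v 1 1 - v 0 1 * v 1 0) = 0 := by linear_combination hdη
  -- Along `1 + s • v`, `det - 1` is a quadratic polynomial in `s` vanishing at 0 and 1, hence equal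
  -- to `s * (s - 1) * det v`.
  have h2 : t * ((t - 1) * (v 0 0 * v 1 1 - v 0 1 * v 1 0)) = 0 := by
    linear_combination hdζ - t * h1
  rcases mul_eq_zero.1 ((mul_eq_zero.1 h2).resolve_left ht0) with h3 | h3
  · apply Subtype.ext
    rw [e1, e2, sub_eq_zero.1 h3, one_smul]
  · obtain ⟨a, ha, hx⟩ := exists_eigenvector_of_nilpotent (hne η hη)
      (by rw [← hv]; linear_combination h1 - h3) h3
    exact (h.2 a ha (hx x (key _ _ hxη)) (hx y (key _ _ hyη)) (hx z (key _ _ hzη))).elim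

/-- The upper unipotent element with entry `t`. -/
def upperUnip (t : F) : SL(2, F) := ⟨!![1, t; 0, 1], by simp [Matrix.det_fin_two]⟩

/-- The Weyl element. -/
def weyl : SL(2, F) := ⟨!![0, 1; -1, 0], by simp [Matrix.det_fin_two]⟩

lemma coe_upperUnip_inv (t : F) : ((upperUnip t)⁻¹ : SL(2, F)).1 = !![1, -t; 0, 1] := by
  rw [Matrix.SpecialLinearGroup.SL2_inv_expl]
  simp [upperUnip]
  rfl

lemma coe_weyl_inv : ((weyl : SL(2, F))⁻¹ : SL(2, F)).1 = !![0, -1; 1, 0] := by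
  rw [Matrix.SpecialLinearGroup.SL2_inv_expl]
  simp [weyl]
  rfl

/-- Such a subspace must contain all trace-zero matrices: unipotent conjugation extracts one
elementary nilpotent, and its conjugates supply the rest. -/
lemma three_le_finrank_of_conj_invariant (h2 : (2 : F) ≠ 0)
    (W : Submodule F (Matrix (Fin 2) (Fin 2) F))
    (hW : ∀ u : SL(2, F), ∀ w ∈ W, u.1 * w * (u⁻¹ : SL(2, F)).1 ∈ W) {x : SL(2, F)}
    (hxW : x.1 ∈ W) (hx : x.1.trace ^ 2 ≠ 4) : 3 ≤ Module.finrank F W := by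
  have hU : ∀ t a b c d : F, !![a, b; c, d] ∈ W →
      !![a + t * c, b + t * d - t * (a + t * c); c, d - t * c] ∈ W := by
    intro t a b c d h
    have := hW (upperUnip t) _ h
    rw [coe_upperUnip_inv, upperUnip] at this
    convert this using 1
    rw [Matrix.mul_fin_two, Matrix.mul_fin_two]
    ext i j
    fin_cases i <;> fin_cases j <;> simp <;> ring
  have hw : ∀ a b c d : F, !![a, b; c, d] ∈ W → !![d, -c; -b, a] ∈ W := by
    intro a b c d h
    have := hW weyl _ h
    rw [coe_weyl_inv, weyl] at this
    convert this using 1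
    rw [Matrix.mul_fin_two, Matrix.mul_fin_two]
    ext i j
    fin_cases i <;> fin_cases j <;> simp
  have hE : !![0, 1; 0, 0] ∈ W → 3 ≤ Module.finrank F W := by
    intro hE
    have hF : !![0, 0; 1, 0] ∈ W := by
      have := W.neg_mem (hw _ _ _ _ hE)
      convert this using 1
      simp
    have hH : !![1, 0; 0, -1] ∈ W := by
      have := W.add_mem (W.sub_mem (hU 1 _ _ _ _ hF) hF) hE
      convert this using 1
      simp
    have hli : LinearIndependent F ![!![0, 1; 0, 0], !![0, 0; 1, 0], !![1, 0; 0, (-1 : F)]] := by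
      rw [Fintype.linearIndependent_iff]
      intro g hg
      rw [Fin.sum_univ_three] at hg
      have h00 := congrFun (congrFun hg 0) 0
      have h01 := congrFun (congrFun hg 0) 1
      have h10 := congrFun (congrFun hg 1) 0
      simp at h00 h01 h10
      intro i
      fin_cases i <;> simp [*]
    have hle : Submodule.span F
        (Set.range ![!![0, 1; 0, 0], !![0, 0; 1, 0], !![1, 0; 0, (-1 : F)]]) ≤ W := by
      rw [Submodule.span_le]
      rintro _ ⟨i, rfl⟩
      fin_cases i <;> simpa
    have := Submodule.finrank_mono hle
    rw [finrank_span_eq_card hli] at this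
    simpa using this
  have hsE : ∀ s : F, s ≠ 0 → !![0, s; 0, 0] ∈ W → !![0, 1; 0, 0] ∈ W := by
    intro s hs h
    have := W.smul_mem s⁻¹ h
    convert this using 1
    simp [hs]
  have hc : ∀ a b c d : F, c ≠ 0 → !![a, b; c, d] ∈ W → !![0, 1; 0, 0] ∈ W := by
    intro a b c d hc h
    apply hsE (2 * c) (mul_ne_zero h2 hc)
    -- This second difference of `w` under conjugation by `upperUnip 1` and its inverse equals `2 *
    -- c` times the elementary nilpotent.
    have := W.sub_mem (W.add_mem h h) (W.add_mem (hU 1 _ _ _ _ h) (hU (-1) _ _ _ _ h))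
    convert this using 1
    ext i j
    fin_cases i <;> fin_cases j <;> simp <;> ring
  apply hE
  have hdet := SL2_det_eq x
  rw [Matrix.trace_fin_two] at hx
  rw [Matrix.eta_fin_two x.1] at hxW
  by_cases h10 : x.1 1 0 = 0
  · by_cases h01 : x.1 0 1 = 0
    · apply hsE (x.1 1 1 - x.1 0 0)
      · intro h
        apply hx
        rw [h10, h01] at hdet
        linear_combination (x.1 1 1 - x.1 0 0) * h + 4 * hdet
      · have := W.sub_mem (hU 1 _ _ _ _ hxW) hxW
        convert this using 1
        simp [h10, h01]
    · exact hc _ _ _ _ (neg_ne_zero.2 h01) (hw _ _ _ _ hxW)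
  · exact hc _ _ _ _ h10 hxW

/-- The stabilizer of a line is a subgroup, and `upperUnip 1` and `weyl` have no invariant line in
common. -/
lemma exists_planeAct_cross_ne_zero {A : Set SL(2, F)} (hA : Subgroup.closure A = ⊤)
    {a : F × F} (ha : a ≠ 0) : ∃ u ∈ A, cross a (planeAct u a) ≠ 0 := by
  by_contra! h
  let H : Subgroup SL(2, F) :=
    { carrier := {u | cross a (planeAct u a) = 0}
      one_mem' := by simp [planeAct_one, cross, mul_comm]
      mul_mem' := by
        intro u v hu hv
        obtain ⟨t, ht⟩ := exists_smul_of_cross_eq_zero ha hv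
        obtain ⟨s, hs⟩ := exists_smul_of_cross_eq_zero ha hu
        have h1 : planeAct u (t • a) = t • planeAct u a := by
          simp only [planeAct, Prod.smul_fst, Prod.smul_snd, smul_eq_mul, Prod.smul_mk,
            Prod.mk.injEq]
          constructor <;> ring
        simp only [Set.mem_ofPred_eq, planeAct_mul, ht, h1, hs]
        simp only [cross, Prod.smul_fst, Prod.smul_snd, smul_eq_mul]
        ring
      inv_mem' := by
        intro u hu
        simp only [Set.mem_ofPred_eq] at hu ⊢
        rw [← cross_planeAct u, ← planeAct_mul, mul_inv_cancel, planeAct_one]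
        simp only [cross] at hu ⊢
        linear_combination -hu }
  have hH : H = ⊤ := by
    rw [eq_top_iff, ← hA, Subgroup.closure_le]
    exact h
  have h1 : upperUnip 1 ∈ H := hH ▸ Subgroup.mem_top _
  have h2 : weyl ∈ H := hH ▸ Subgroup.mem_top _
  obtain ⟨a1, a2⟩ := a
  change cross _ _ = 0 at h1
  change cross _ _ = 0 at h2
  simp [cross, planeAct, upperUnip, weyl] at h1 h2
  have h3 : a2 = 0 := by
    have : a2 ^ 2 = 0 := by linear_combination -h1
    exact pow_eq_zero_iff (two_ne_zero) |>.1 this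
  subst h3
  have h4 : a1 = 0 := by simpa using h2
  exact ha (by simp [h4])

lemma exists_conj_not_mem [DecidableEq F] {A : Finset SL(2, F)} (hsymm : A⁻¹ = A)
    (hA : Subgroup.closure (A : Set SL(2, F)) = ⊤) (h2 : (2 : F) ≠ 0)
    (W : Submodule F (Matrix (Fin 2) (Fin 2) F)) (hWf : Module.finrank F W ≤ 2) {x : SL(2, F)}
    (hxW : x.1 ∈ W) (hx : x.1.trace ^ 2 ≠ 4) :
    ∃ u ∈ A, ∃ w ∈ W, u.1 * w * (u⁻¹ : SL(2, F)).1 ∉ W := by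
  by_contra! h
  let H : Subgroup SL(2, F) :=
    -- Both `u` and its inverse are required to preserve `W`, which makes closure under inversion
    -- immediate; symmetry of `A` supplies the second condition.
    { carrier := {u | ∀ w ∈ W, u.1 * w * (u⁻¹ : SL(2, F)).1 ∈ W ∧
        (u⁻¹ : SL(2, F)).1 * w * u.1 ∈ W}
      one_mem' := by simp
      mul_mem' := by
        intro u v hu hv w hw
        constructor
        · have := (hu _ (hv _ hw).1).1
          simpa only [mul_inv_rev, Matrix.SpecialLinearGroup.coe_mul, mul_assoc] using this
        · have := (hv _ (hu _ hw).2).2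
          simpa only [mul_inv_rev, Matrix.SpecialLinearGroup.coe_mul, mul_assoc] using this
      inv_mem' := by
        intro u hu w hw
        rw [inv_inv]
        exact (hu w hw).symm }
  have hH : H = ⊤ := by
    rw [eq_top_iff, ← hA, Subgroup.closure_le]
    intro u hu w hw
    refine ⟨h u hu w hw, ?_⟩
    have hu' : u⁻¹ ∈ A := by
      rw [← hsymm]; exact Finset.inv_mem_inv hu
    have := h u⁻¹ hu' w hw
    rwa [inv_inv] at this
  have := three_le_finrank_of_conj_invariant h2 W
    (fun u w hw => ((hH ▸ Subgroup.mem_top u : u ∈ H) w hw).1) hxW hx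
  omega

end General

/-! ### Many triples in general position inside a set of constant trace. -/

section Counting

lemma exists_finset_triples {α : Type*} [DecidableEq α] (X : Finset α) (Y : α → Finset α)
    (Z : α → α → Finset α) {k : ℕ} (hX : k ≤ X.card) (hY : ∀ x ∈ X, k ≤ (Y x).card)
    (hZ : ∀ x ∈ X, ∀ y ∈ Y x, k ≤ (Z x y).card) :
    ∃ T : Finset (α × α × α), k ^ 3 ≤ T.card ∧
      ∀ t ∈ T, t.1 ∈ X ∧ t.2.1 ∈ Y t.1 ∧ t.2.2 ∈ Z t.1 t.2.1 := by
  refine ⟨(X.sigma fun x => (Y x).sigma (Z x)).image fun t => (t.1, t.2.1, t.2.2), ?_, ?_⟩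
  · rw [Finset.card_image_of_injective, Finset.card_sigma]
    · calc k ^ 3 = k * (k * k) := by ring
        _ ≤ X.card * (k * k) := Nat.mul_le_mul_right _ hX
        _ = ∑ x ∈ X, k * k := by rw [Finset.sum_const, smul_eq_mul]
        _ ≤ _ := by
            refine Finset.sum_le_sum fun x hx => ?_
            rw [Finset.card_sigma]
            calc k * k ≤ (Y x).card * k := Nat.mul_le_mul_right _ (hY x hx)
              _ = ∑ y ∈ Y x, k := by rw [Finset.sum_const, smul_eq_mul]
              _ ≤ _ := Finset.sum_le_sum fun y hy => hZ x hx y hy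
    · rintro ⟨x, y, z⟩ ⟨x', y', z'⟩ h
      simpa using h
  · intro t ht
    simp only [Finset.mem_image, Finset.mem_sigma] at ht
    obtain ⟨s, hs, rfl⟩ := ht
    exact hs

variable {F : Type*} [Field F]

lemma linearIndependent_triple {x y z : Matrix (Fin 2) (Fin 2) F} (hy : y ≠ 0)
    (hz : z ∉ Submodule.span F {y}) (hx : x ∉ Submodule.span F {y, z}) :
    LinearIndependent F ![x, y, z] := by
  have h1 : LinearIndependent F ![y, z] := by
    rw [LinearIndependent.pair_iff' hy]
    intro a ha
    exact hz (Submodule.mem_span_singleton.2 ⟨a, ha⟩)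
  have h2 : Set.range ![y, z] = {y, z} := by simp [Set.pair_comm]
  exact linearIndependent_finCons.2 ⟨h1, by rwa [h2]⟩

lemma linearIndependent_triple' {x y z : Matrix (Fin 2) (Fin 2) F} (hx : x ≠ 0)
    (hy : y ∉ Submodule.span F {x}) (hz : z ∉ Submodule.span F {x, y}) :
    LinearIndependent F ![x, y, z] := by
  have h1 := (linearIndependent_triple hx hy hz).comp ![1, 2, 0] (by decide)
  convert h1 using 1
  ext i
  fin_cases i <;> rfl

lemma SL2_ne_zero (x : SL(2, F)) : x.1 ≠ 0 := by
  intro h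
  have := x.2
  rw [h] at this
  simp at this

variable [DecidableEq F]

open Classical in
lemma card_filter_mem_span_le (S : Finset SL(2, F)) (y : SL(2, F)) :
    (S.filter fun z => z.1 ∈ Submodule.span F {y.1}).card ≤ 2 := by
  refine (Finset.card_le_card (t := {y, -y}) ?_).trans Finset.card_le_two
  intro z hz
  rw [Finset.mem_filter] at hz
  simpa using eq_or_eq_neg_of_mem_span y z hz.2

open Classical in
lemma card_filter_common_eigenlines_le (h2 : (2 : F) ≠ 0) (S : Finset SL(2, F)) {τ : F}
    (hS : ∀ x ∈ S, x.1.trace = τ) {a b : F × F} (hab : cross a b ≠ 0) :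
    (S.filter fun z => eigenForm z.1 a = 0 ∧ eigenForm z.1 b = 0).card ≤ 2 := by
  rcases Finset.eq_empty_or_nonempty
    (S.filter fun z => eigenForm z.1 a = 0 ∧ eigenForm z.1 b = 0) with h | ⟨x, hx⟩
  · rw [h]; simp
  · rw [Finset.mem_filter] at hx
    refine (Finset.card_le_card (t := {x, x⁻¹}) ?_).trans Finset.card_le_two
    intro z hz
    rw [Finset.mem_filter] at hz
    simpa using eq_or_eq_inv_of_common_eigenlines h2 ((hS z hz.1).trans (hS x hx.1).symm) hab
      hx.2.1 hx.2.2 hz.2.1 hz.2.2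

open Classical in
lemma card_filter_common_eigenvector_le (S : Finset SL(2, F)) {x : SL(2, F)}
    (hx : x.1.trace ^ 2 ≠ 4) {t : ℕ}
    (ht : ∀ a, a ≠ 0 → (S.filter fun z => eigenForm z.1 a = 0).card ≤ t) :
    (S.filter fun z => ∃ a, a ≠ 0 ∧ eigenForm x.1 a = 0 ∧ eigenForm z.1 a = 0).card ≤ 2 * t := by
  obtain ⟨e₁, e₂, h₁, h₂, he⟩ := exists_eigenlines hx
  calc _ ≤ ((S.filter fun z => eigenForm z.1 e₁ = 0) ∪
        (S.filter fun z => eigenForm z.1 e₂ = 0)).card := by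
        refine Finset.card_le_card fun z hz => ?_
        simp only [Finset.mem_filter, Finset.mem_union] at hz ⊢
        obtain ⟨hzS, a, ha, hxa, hza⟩ := hz
        have key : ∀ e, cross e a = 0 → eigenForm z.1 e = 0 := fun e he =>
          eigenForm_eq_zero_of_cross ha (by simp only [cross] at he ⊢; linear_combination -he) hza
        rcases he a ha hxa with h | h
        · exact Or.inl ⟨hzS, key _ h⟩
        · exact Or.inr ⟨hzS, key _ h⟩
    _ ≤ _ := Finset.card_union_le _ _
    _ ≤ t + t := add_le_add (ht _ h₁) (ht _ h₂)
    _ = 2 * t := by ring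

lemma card_filter_not_ge {α : Type*} (S : Finset α) (P : α → Prop) [DecidablePred P] {t : ℕ}
    (h : (S.filter P).card ≤ t) : S.card - t ≤ (S.filter fun x => ¬ P x).card := by
  have := Finset.card_filter_add_card_filter_not (s := S) P
  omega

/-- Triples of which a positive proportion is in general position, one entry being conjugated. -/
def HasManyTriples (A S : Finset SL(2, F)) : Prop :=
  ∃ u ∈ insert 1 A, ∃ k : ℕ, ∃ T : Finset (SL(2, F) × SL(2, F) × SL(2, F)),
    S.card ≤ 16 * k ∧ k ^ 3 ≤ T.card ∧ ∀ t ∈ T, t.1 ∈ S ∧ t.2.1 ∈ S ∧ t.2.2 ∈ S ∧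
      GeneralPosition (u * t.1 * u⁻¹ : SL(2, F)).1 t.2.1.1 t.2.2.1

open Classical in
-- All three entries are drawn from the elements fixing the line of `a`, and the first is conjugated
-- by some `u` that moves this line. The conjugate usually loses the eigenvector `a`, so it leaves
-- the hyperplane `eigenForm · a = 0` that contains the other two.
lemma hasManyTriples_of_eigenvector (h2 : (2 : F) ≠ 0) {A : Finset SL(2, F)}
    (hA : Subgroup.closure (A : Set SL(2, F)) = ⊤) (S : Finset SL(2, F)) {τ : F}
    (hτ : τ ^ 2 ≠ 4) (hS : ∀ x ∈ S, x.1.trace = τ) (hcard : 64 ≤ S.card) {a : F × F}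
    (ha : a ≠ 0) (h : S.card < 8 * (S.filter fun z => eigenForm z.1 a = 0).card) :
    HasManyTriples A S := by
  obtain ⟨u, huA, hu⟩ := exists_planeAct_cross_ne_zero hA ha
  set Sa := S.filter fun z => eigenForm z.1 a = 0 with hSa
  have hSaS : ∀ x ∈ Sa, x ∈ S := fun x hx => (Finset.mem_filter.1 hx).1
  have hSaa : ∀ x ∈ Sa, eigenForm x.1 a = 0 := fun x hx => (Finset.mem_filter.1 hx).2
  have hSaτ : ∀ x ∈ Sa, x.1.trace = τ := fun x hx => hS x (hSaS x hx)
  have huu : ∀ b, planeAct u (planeAct u⁻¹ b) = b := by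
    intro b; rw [← planeAct_mul, mul_inv_cancel, planeAct_one]
  have hua : cross a (planeAct u⁻¹ a) ≠ 0 := by
    rw [← cross_planeAct u, huu]
    intro h; apply hu
    simp only [cross] at h ⊢; linear_combination -h
  let X := Sa.filter fun x => ¬ eigenForm (u * x * u⁻¹ : SL(2, F)).1 a = 0
  let Y : SL(2, F) → Finset SL(2, F) := fun x => Sa.filter fun y =>
    ¬ ∃ b, b ≠ 0 ∧ eigenForm (u * x * u⁻¹ : SL(2, F)).1 b = 0 ∧ eigenForm y.1 b = 0
  let Z : SL(2, F) → SL(2, F) → Finset SL(2, F) := fun _ y =>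
    Sa.filter fun z => ¬ z.1 ∈ Submodule.span F {y.1}
  have hXc : Sa.card - 2 ≤ X.card := by
    apply card_filter_not_ge
    refine le_trans (Finset.card_le_card fun x hx => ?_)
      (card_filter_common_eigenlines_le h2 Sa hSaτ hua)
    rw [Finset.mem_filter] at hx ⊢
    refine ⟨hx.1, hSaa x hx.1, ?_⟩
    rw [← eigenForm_conj u, huu]
    exact hx.2
  -- The conjugate has at most two eigenlines, neither equal to that of `a`. An element `y` of `Sa`
  -- sharing one of them has two prescribed eigenlines, which leaves two choices for each.
  have hYc : ∀ x ∈ X, Sa.card - 4 ≤ (Y x).card := by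
    intro x hx
    have hx' := Finset.mem_filter.1 hx
    apply card_filter_not_ge
    obtain ⟨e₁, e₂, h₁, h₂, he⟩ := exists_eigenlines (x := u * x * u⁻¹)
      (by rw [trace_conj, hSaτ x hx'.1]; exact hτ)
    have key : ∀ e : F × F, e ≠ 0 → (Sa.filter fun y => ∃ b, b ≠ 0 ∧ cross e b = 0 ∧
        eigenForm (u * x * u⁻¹ : SL(2, F)).1 b = 0 ∧ eigenForm y.1 b = 0).card ≤ 2 := by
      intro e he0
      by_cases hc : cross a e = 0
      · rw [Finset.card_eq_zero.2]
        · norm_num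
        rw [Finset.filter_eq_empty_iff]
        rintro y hy ⟨b, hb, heb, hxb, hyb⟩
        apply hx'.2
        refine eigenForm_eq_zero_of_cross he0 (by simp only [cross] at hc ⊢; linear_combination -hc)
          (eigenForm_eq_zero_of_cross hb (by simp only [cross] at heb ⊢; linear_combination -heb)
            hxb)
      · refine le_trans (Finset.card_le_card fun y hy => ?_)
          (card_filter_common_eigenlines_le h2 Sa hSaτ hc)
        rw [Finset.mem_filter] at hy ⊢
        obtain ⟨hy1, b, hb, heb, hxb, hyb⟩ := hy
        exact ⟨hy1, hSaa y hy1, eigenForm_eq_zero_of_cross hb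
          (by simp only [cross] at heb ⊢; linear_combination -heb) hyb⟩
    have h1 := key e₁ h₁
    have h2 := key e₂ h₂
    have h3 : (Sa.filter fun y => ∃ b, b ≠ 0 ∧
        eigenForm (u * x * u⁻¹ : SL(2, F)).1 b = 0 ∧ eigenForm y.1 b = 0) ⊆
        (Sa.filter fun y => ∃ b, b ≠ 0 ∧ cross e₁ b = 0 ∧
          eigenForm (u * x * u⁻¹ : SL(2, F)).1 b = 0 ∧ eigenForm y.1 b = 0) ∪
        (Sa.filter fun y => ∃ b, b ≠ 0 ∧ cross e₂ b = 0 ∧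
          eigenForm (u * x * u⁻¹ : SL(2, F)).1 b = 0 ∧ eigenForm y.1 b = 0) := by
      intro y hy
      rw [Finset.mem_filter] at hy
      obtain ⟨hy1, b, hb, hxb, hyb⟩ := hy
      rcases he b hb hxb with h | h
      · exact Finset.mem_union_left _ (Finset.mem_filter.2 ⟨hy1, b, hb, h, hxb, hyb⟩)
      · exact Finset.mem_union_right _ (Finset.mem_filter.2 ⟨hy1, b, hb, h, hxb, hyb⟩)
    have h4 := (Finset.card_le_card h3).trans (Finset.card_union_le _ _)
    omega
  have hZc : ∀ x ∈ X, ∀ y ∈ Y x, Sa.card - 2 ≤ (Z x y).card := fun x _ y _ =>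
    card_filter_not_ge _ _ (card_filter_mem_span_le Sa y)
  -- The assumption `64 ≤ S.card` gives `Sa.card ≥ 9`, so that `8 * Sa.card ≤ 16 * (Sa.card - 4)`.
  obtain ⟨T, hT, hTm⟩ := exists_finset_triples X Y Z (k := Sa.card - 4) (by omega)
    (fun x hx => hYc x hx) (fun x hx y hy => by have := hZc x hx y hy; omega)
  refine ⟨u, Finset.mem_insert_of_mem huA, Sa.card - 4, T, by omega, hT, ?_⟩
  rintro ⟨x, y, z⟩ ht
  obtain ⟨hx, hy, hz⟩ := hTm _ ht
  simp only [X, Y, Z, Finset.mem_filter] at hx hy hz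
  refine ⟨hSaS x hx.1, hSaS y hy.1, hSaS z hz.1, ?_, ?_⟩
  · apply linearIndependent_triple (SL2_ne_zero y) hz.2
    intro hmem
    apply hx.2
    obtain ⟨c, d, hcd⟩ := Submodule.mem_span_pair.1 hmem
    simp only at hcd
    rw [← hcd, eigenForm_add, eigenForm_smul, eigenForm_smul, hSaa y hy.1, hSaa z hz.1]
    ring
  · intro b hb hxb hyb _
    exact hy.2 ⟨b, hb, hxb, hyb⟩

open Classical in
-- Conjugation by some `u` in `A` moves the plane `W`, so it pushes most of its elements out of `W`.
-- The other two entries stay in `W` and are chosen independent and without a common eigenvector.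
lemma hasManyTriples_of_plane (h2 : (2 : F) ≠ 0) {A : Finset SL(2, F)} (hsymm : A⁻¹ = A)
    (hA : Subgroup.closure (A : Set SL(2, F)) = ⊤) (S : Finset SL(2, F)) {τ : F}
    (hτ : τ ^ 2 ≠ 4) (hS : ∀ x ∈ S, x.1.trace = τ) (hcard : 64 ≤ S.card)
    (hline : ∀ a, a ≠ 0 → (S.filter fun z => eigenForm z.1 a = 0).card ≤ S.card / 8)
    (W : Submodule F (Matrix (Fin 2) (Fin 2) F)) (hW : Module.finrank F W ≤ 2)
    (h : S.card < 2 * (S.filter fun z => z.1 ∈ W).card) :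
    HasManyTriples A S := by
  set SW := S.filter fun z => z.1 ∈ W with hSW
  have hSWS : ∀ x ∈ SW, x ∈ S := fun x hx => (Finset.mem_filter.1 hx).1
  have hSWW : ∀ x ∈ SW, x.1 ∈ W := fun x hx => (Finset.mem_filter.1 hx).2
  have hne : SW.Nonempty := by
    rw [← Finset.card_pos]; omega
  obtain ⟨x₀, hx₀⟩ := hne
  obtain ⟨u, huA, w, hwW, hw⟩ := exists_conj_not_mem hsymm hA h2 W hW (hSWW x₀ hx₀)
    (by rw [hS x₀ (hSWS x₀ hx₀)]; exact hτ)
  let X := SW.filter fun x => ¬ (u * x * u⁻¹ : SL(2, F)).1 ∈ W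
  let Y : SL(2, F) → Finset SL(2, F) := fun _ => SW
  let Z : SL(2, F) → SL(2, F) → Finset SL(2, F) := fun _ y =>
    (SW.filter fun z => ¬ ∃ b, b ≠ 0 ∧ eigenForm y.1 b = 0 ∧ eigenForm z.1 b = 0).filter
      fun z => ¬ z.1 ∈ Submodule.span F {y.1}
  have hXc : SW.card - 2 ≤ X.card := by
    apply card_filter_not_ge
    rcases Finset.eq_empty_or_nonempty
      (SW.filter fun x => (u * x * u⁻¹ : SL(2, F)).1 ∈ W) with h0 | ⟨x₁, hx₁⟩
    · rw [h0]; simp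
    refine le_trans (Finset.card_le_card fun x₂ hx₂ => ?_) (card_filter_mem_span_le SW x₁)
    rw [Finset.mem_filter] at hx₁ hx₂ ⊢
    refine ⟨hx₂.1, ?_⟩
    -- Two independent elements of `W` span it; if both conjugates stayed in `W`, all of `W` would
    -- be preserved by `u`.
    by_contra hspan
    apply hw
    have hli : LinearIndependent F ![x₁.1, x₂.1] := by
      rw [LinearIndependent.pair_iff' (SL2_ne_zero x₁)]
      intro c hc
      exact hspan (Submodule.mem_span_singleton.2 ⟨c, hc⟩)
    have hle : Submodule.span F (Set.range ![x₁.1, x₂.1]) ≤ W := by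
      rw [Submodule.span_le]
      rintro _ ⟨i, rfl⟩
      fin_cases i
      · exact hSWW x₁ hx₁.1
      · exact hSWW x₂ hx₂.1
    have heq := Submodule.eq_of_le_of_finrank_le hle
      (by rw [finrank_span_eq_card hli]; simpa using hW)
    rw [← heq] at hwW
    simp only [Matrix.range_cons, Matrix.range_empty, Set.union_empty, Set.singleton_union] at hwW
    obtain ⟨c, d, hcd⟩ := Submodule.mem_span_pair.1 hwW
    have : u.1 * w * (u⁻¹ : SL(2, F)).1 =
        c • (u * x₁ * u⁻¹ : SL(2, F)).1 + d • (u * x₂ * u⁻¹ : SL(2, F)).1 := by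
      rw [← hcd]
      simp only [Matrix.SpecialLinearGroup.coe_mul, mul_add, add_mul, Matrix.mul_smul,
        Matrix.smul_mul]
    rw [this]
    exact W.add_mem (W.smul_mem _ hx₁.2) (W.smul_mem _ hx₂.2)
  have hZc : ∀ x ∈ X, ∀ y ∈ Y x, SW.card - 2 * (S.card / 8) - 2 ≤ (Z x y).card := by
    intro x _ y hy
    have h1 := card_filter_not_ge
      (SW.filter fun z => ¬ ∃ b, b ≠ 0 ∧ eigenForm y.1 b = 0 ∧ eigenForm z.1 b = 0)
      (fun z => z.1 ∈ Submodule.span F {y.1}) (card_filter_mem_span_le _ y)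
    have h2 := card_filter_not_ge SW
      (fun z => ∃ b, b ≠ 0 ∧ eigenForm y.1 b = 0 ∧ eigenForm z.1 b = 0)
      (card_filter_common_eigenvector_le SW (x := y) (by rw [hS y (hSWS y hy)]; exact hτ)
        (t := S.card / 8) (fun a ha => le_trans (Finset.card_le_card
          (Finset.filter_subset_filter _ (Finset.filter_subset _ _))) (hline a ha)))
    simp only [Z]
    omega
  obtain ⟨T, hT, hTm⟩ := exists_finset_triples X Y Z (k := SW.card - 2 * (S.card / 8) - 2)
    (by omega) (fun x hx => by simp only [Y]; omega) hZc
  refine ⟨u, Finset.mem_insert_of_mem huA, _, T, by omega, hT, ?_⟩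
  rintro ⟨x, y, z⟩ ht
  obtain ⟨hx, hy, hz⟩ := hTm _ ht
  simp only [X, Y, Z, Finset.mem_filter] at hx hy hz
  refine ⟨hSWS x hx.1, hSWS y hy, hSWS z hz.1.1, ?_, ?_⟩
  · apply linearIndependent_triple (SL2_ne_zero y) hz.2
    intro hmem
    apply hx.2
    refine Submodule.span_le.2 ?_ hmem
    rintro m (rfl | rfl)
    · exact hSWW y hy
    · exact hSWW z hz.1.1
  · intro b hb _ hyb hzb
    exact hz.1.2 ⟨b, hb, hyb, hzb⟩

/-- If neither an eigenline nor a plane captures a large share of `S`, greedy choice succeeds with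
no conjugation, that is with `u = 1`. -/
lemma hasManyTriples (h2 : (2 : F) ≠ 0) {A : Finset SL(2, F)} (hsymm : A⁻¹ = A)
    (hA : Subgroup.closure (A : Set SL(2, F)) = ⊤) (S : Finset SL(2, F)) {τ : F}
    (hτ : τ ^ 2 ≠ 4) (hS : ∀ x ∈ S, x.1.trace = τ) (hcard : 64 ≤ S.card) :
    HasManyTriples A S := by
  classical
  by_cases hline : ∃ a : F × F, a ≠ 0 ∧
      S.card < 8 * (S.filter fun z => eigenForm z.1 a = 0).card
  · obtain ⟨a, ha, h⟩ := hline
    exact hasManyTriples_of_eigenvector h2 hA S hτ hS hcard ha (by convert h)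
  push Not at hline
  have hline' : ∀ a : F × F, a ≠ 0 →
      (S.filter fun z => eigenForm z.1 a = 0).card ≤ S.card / 8 := by
    intro a ha
    have := hline a ha
    omega
  by_cases hplane : ∃ x y : SL(2, F),
      S.card < 2 * (S.filter fun z => z.1 ∈ Submodule.span F {x.1, y.1}).card
  · obtain ⟨x, y, h⟩ := hplane
    refine hasManyTriples_of_plane h2 hsymm hA S hτ hS hcard (fun a ha => by convert hline' a ha)
      (Submodule.span F {x.1, y.1}) ?_ (by convert h)
    have h3 : Set.range ![x.1, y.1] = {x.1, y.1} := by simp [Set.pair_comm]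
    rw [← h3]
    exact finrank_range_le_card (R := F) ![x.1, y.1]
  push Not at hplane
  let Y : SL(2, F) → Finset SL(2, F) := fun x =>
    (S.filter fun z => ¬ ∃ b, b ≠ 0 ∧ eigenForm x.1 b = 0 ∧ eigenForm z.1 b = 0).filter
      fun z => ¬ z.1 ∈ Submodule.span F {x.1}
  let Z : SL(2, F) → SL(2, F) → Finset SL(2, F) := fun x y =>
    S.filter fun z => ¬ z.1 ∈ Submodule.span F {x.1, y.1}
  have hYc : ∀ x ∈ S, S.card - 2 * (S.card / 8) - 2 ≤ (Y x).card := by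
    intro x hx
    have h1 := card_filter_not_ge
      (S.filter fun z => ¬ ∃ b, b ≠ 0 ∧ eigenForm x.1 b = 0 ∧ eigenForm z.1 b = 0)
      (fun z => z.1 ∈ Submodule.span F {x.1}) (by convert card_filter_mem_span_le _ x)
    have h2 := card_filter_not_ge S
      (fun z => ∃ b, b ≠ 0 ∧ eigenForm x.1 b = 0 ∧ eigenForm z.1 b = 0)
      (by convert card_filter_common_eigenvector_le S (x := x) (by rw [hS x hx]; exact hτ)
            (t := S.card / 8) (fun a ha => by convert hline' a ha))
    simp only [Y]
    omega
  have hZc : ∀ x ∈ S, ∀ y ∈ Y x, S.card - S.card / 2 ≤ (Z x y).card := by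
    intro x _ y _
    apply card_filter_not_ge
    have := hplane x y
    omega
  obtain ⟨T, hT, hTm⟩ := exists_finset_triples S Y Z (k := S.card / 2) (by omega)
    (fun x hx => by have := hYc x hx; omega)
    (fun x hx y hy => by have := hZc x hx y hy; omega)
  refine ⟨1, Finset.mem_insert_self _ _, _, T, by omega, hT, ?_⟩
  rintro ⟨x, y, z⟩ ht
  obtain ⟨hx, hy, hz⟩ := hTm _ ht
  simp only [Y, Z, Finset.mem_filter] at hx hy hz
  refine ⟨hx, hy.1.1, hz.1, ?_, ?_⟩
  · simp only [one_mul, inv_one, mul_one]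
    exact linearIndependent_triple' (SL2_ne_zero x) hy.2 hz.2
  · intro b hb hxb hyb _
    simp only [one_mul, inv_one, mul_one] at hxb
    exact hy.1.2 ⟨b, hb, hxb, hyb⟩

end Counting

/-! ### Products in a symmetric set, and orbit-stabilizer for conjugation. -/

section Group

variable {G : Type*} [Group G] [DecidableEq G]

lemma inv_mem_pow_of_symm {A : Finset G} (hsymm : A⁻¹ = A) {n : ℕ} {x : G} (hx : x ∈ A ^ n) :
    x⁻¹ ∈ A ^ n := by
  have := Finset.inv_mem_inv hx
  rwa [← inv_pow, hsymm] at this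

lemma mem_pow_add {A : Finset G} {m n : ℕ} {x y : G} (hx : x ∈ A ^ m) (hy : y ∈ A ^ n) :
    x * y ∈ A ^ (m + n) := by
  rw [pow_add]; exact Finset.mul_mem_mul hx hy

open Classical in
-- Two elements of `A` giving the same conjugate of `g` differ by a quotient in `A ^ 2` that
-- centralizes `g`.
lemma card_le_card_centralizer_mul_card_conj {A : Finset G} (hsymm : A⁻¹ = A) (g : G) :
    A.card ≤ ((A ^ 2).filter fun v => Commute g v).card *
      (A.image fun a => a * g * a⁻¹).card := by
  refine Finset.card_le_mul_card_image A _ fun b hb => ?_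
  obtain ⟨a₀, ha₀, rfl⟩ := Finset.mem_image.1 hb
  refine Finset.card_le_card_of_injOn (fun a => a₀⁻¹ * a) ?_ (by intro x _ y _ h; simpa using h)
  intro a ha
  simp only [Finset.coe_filter, Set.mem_ofPred_eq] at ha ⊢
  constructor
  · rw [pow_two]
    refine Finset.mul_mem_mul ?_ ha.1
    rw [← hsymm]; exact Finset.inv_mem_inv ha₀
  · have h := ha.2
    have h' : a * g = a₀ * g * a₀⁻¹ * a := by rw [← h]; group
    change g * (a₀⁻¹ * a) = a₀⁻¹ * a * g
    rw [mul_assoc a₀⁻¹ a g, h']; group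

end Group

/-! ### Centralizers of regular elements. -/

section SL2

variable {F : Type*} [Field F]

lemma commute_iff_entries {x y : SL(2, F)} : Commute x y ↔
    x 0 1 * y 1 0 = y 0 1 * x 1 0 ∧
    x 0 1 * (y 1 1 - y 0 0) = y 0 1 * (x 1 1 - x 0 0) ∧
    x 1 0 * (y 1 1 - y 0 0) = y 1 0 * (x 1 1 - x 0 0) := by
  constructor
  · intro h
    have h00 := congrArg (fun m : SL(2, F) => m 0 0) h.eq
    have h01 := congrArg (fun m : SL(2, F) => m 0 1) h.eq
    have h10 := congrArg (fun m : SL(2, F) => m 1 0) h.eq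
    simp only [SL2_mul_apply] at h00 h01 h10
    exact ⟨by linear_combination h00, by linear_combination h01, by linear_combination -h10⟩
  · rintro ⟨h1, h2, h3⟩
    apply SL2_ext <;> rw [SL2_mul_apply, SL2_mul_apply]
    · linear_combination h1
    · linear_combination h2
    · linear_combination -h3
    · linear_combination -h1

lemma trace_sq_sub_four (x : SL(2, F)) :
    x.1.trace ^ 2 - 4 = (x 1 1 - x 0 0) ^ 2 + 4 * (x 0 1 * x 1 0) := by
  have := SL2_det_eq x
  rw [Matrix.trace_fin_two]
  linear_combination 4 * this

/-- Commuting means having proportional trace-free parts, and that of a regular `g` is nonzero. The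
factor `s` is the coordinate on the torus used below. -/
lemma exists_factor_of_commute {g x : SL(2, F)} (hg : g.1.trace ^ 2 ≠ 4) (h : Commute g x) :
    ∃ s : F, x 0 1 = s * g 0 1 ∧ x 1 0 = s * g 1 0 ∧ x 1 1 - x 0 0 = s * (g 1 1 - g 0 0) := by
  obtain ⟨h1, h2, h3⟩ := commute_iff_entries.1 h
  by_cases k1 : g 0 1 = 0
  · by_cases k3 : g 1 1 - g 0 0 = 0
    · exfalso
      apply hg
      have := trace_sq_sub_four g
      rw [k1, k3] at this
      linear_combination this
    · refine ⟨(x 1 1 - x 0 0) / (g 1 1 - g 0 0), ?_, ?_, ?_⟩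
      · field_simp; linear_combination -h2
      · field_simp; linear_combination -h3
      · field_simp
  · refine ⟨x 0 1 / g 0 1, ?_, ?_, ?_⟩
    · field_simp
    · field_simp; linear_combination h1
    · field_simp; linear_combination h2

lemma eq_one_or_neg_one_of_scalar {x : SL(2, F)} (h1 : x 0 1 = 0) (h2 : x 1 0 = 0)
    (h3 : x 1 1 - x 0 0 = 0) : x = 1 ∨ x = -1 := by
  have hd := SL2_det_eq x
  have h4 : x 1 1 = x 0 0 := by linear_combination h3
  rw [h1, h4] at hd
  have h5 : (x 0 0 - 1) * (x 0 0 + 1) = 0 := by linear_combination hd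
  rcases mul_eq_zero.1 h5 with h | h
  · left
    apply SL2_ext <;> simp [h1, h2, h4, sub_eq_zero.1 h]
  · right
    apply SL2_ext <;> simp [h1, h2, h4, eq_neg_of_add_eq_zero_left h]

lemma trace_sq_ne_four_of_commute {g x : SL(2, F)} (hg : g.1.trace ^ 2 ≠ 4) (h : Commute g x)
    (hx : ¬ (x = 1 ∨ x = -1)) : x.1.trace ^ 2 ≠ 4 := by
  obtain ⟨s, h1, h2, h3⟩ := exists_factor_of_commute hg h
  have hs : s ≠ 0 := by
    rintro rfl
    exact hx (eq_one_or_neg_one_of_scalar (by simpa using h1) (by simpa using h2)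
      (by simpa using h3))
  have k1 := trace_sq_sub_four g
  have k2 := trace_sq_sub_four x
  rw [h1, h2, h3] at k2
  have : x.1.trace ^ 2 - 4 = s ^ 2 * (g.1.trace ^ 2 - 4) := by rw [k1, k2]; ring
  rw [← sub_ne_zero, this]
  exact mul_ne_zero (pow_ne_zero _ hs) (sub_ne_zero.2 hg)

lemma commute_of_commute {g x y : SL(2, F)} (hg : g.1.trace ^ 2 ≠ 4) (hx : Commute g x)
    (hy : Commute g y) : Commute x y := by
  obtain ⟨s, h1, h2, h3⟩ := exists_factor_of_commute hg hx
  obtain ⟨t, k1, k2, k3⟩ := exists_factor_of_commute hg hy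
  rw [commute_iff_entries, h1, h2, h3, k1, k2, k3]
  refine ⟨?_, ?_, ?_⟩ <;> ring

lemma eq_or_eq_inv_of_commute (h2 : (2 : F) ≠ 0) {g x y : SL(2, F)} (hg : g.1.trace ^ 2 ≠ 4)
    (hx : Commute g x) (hy : Commute g y) (ht : x.1.trace = y.1.trace) : y = x ∨ y = x⁻¹ := by
  obtain ⟨s, s1, s2, s3⟩ := exists_factor_of_commute hg hx
  obtain ⟨t, t1, t2, t3⟩ := exists_factor_of_commute hg hy
  have kg := trace_sq_sub_four g
  have kx := trace_sq_sub_four x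
  have ky := trace_sq_sub_four y
  rw [s1, s2, s3] at kx
  rw [t1, t2, t3, ← ht] at ky
  have h : (s ^ 2 - t ^ 2) * (g.1.trace ^ 2 - 4) = 0 := by
    rw [kg]; linear_combination ky - kx
  have hst : (s - t) * (s + t) = 0 := by
    have := (mul_eq_zero.1 h).resolve_right (sub_ne_zero.2 hg)
    linear_combination this
  rw [Matrix.trace_fin_two, Matrix.trace_fin_two] at ht
  rcases mul_eq_zero.1 hst with h | h
  · left
    have hs : s = t := sub_eq_zero.1 h
    subst hs
    refine SL2_ext (mul_left_cancel₀ h2 ?_) ?_ ?_ (mul_left_cancel₀ h2 ?_)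
    · linear_combination -ht - t3 + s3
    · rw [s1, t1]
    · rw [s2, t2]
    · linear_combination -ht + t3 - s3
  · right
    obtain ⟨i1, i2, i3, i4⟩ := SL2_inv_apply x
    refine SL2_ext (mul_left_cancel₀ h2 ?_) ?_ ?_ (mul_left_cancel₀ h2 ?_)
    · rw [i1]; linear_combination -ht - t3 - s3 - (g 1 1 - g 0 0) * h
    · rw [i2, s1, t1]; linear_combination g 0 1 * h
    · rw [i3, s2, t2]; linear_combination g 1 0 * h
    · rw [i4]; linear_combination -ht + t3 + s3 + (g 1 1 - g 0 0) * h

lemma eq_or_eq_neg_inv_of_factor_eq (h2 : (2 : F) ≠ 0) {x y : SL(2, F)} (h01 : x 0 1 = y 0 1)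
    (h10 : x 1 0 = y 1 0) (hd : x 1 1 - x 0 0 = y 1 1 - y 0 0) : y = x ∨ y = -x⁻¹ := by
  have kx := trace_sq_sub_four x
  have ky := trace_sq_sub_four y
  rw [← h01, ← h10, ← hd, ← kx] at ky
  have h : (y.1.trace - x.1.trace) * (y.1.trace + x.1.trace) = 0 := by linear_combination ky
  rw [Matrix.trace_fin_two, Matrix.trace_fin_two] at h
  rcases mul_eq_zero.1 h with h | h
  · left
    refine SL2_ext (mul_left_cancel₀ h2 ?_) h01.symm h10.symm (mul_left_cancel₀ h2 ?_)
    · linear_combination h + hd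
    · linear_combination h - hd
  · right
    obtain ⟨i1, i2, i3, i4⟩ := SL2_inv_apply x
    refine SL2_ext (mul_left_cancel₀ h2 ?_) ?_ ?_ (mul_left_cancel₀ h2 ?_)
    all_goals
      simp only [Matrix.SpecialLinearGroup.coe_neg, Matrix.neg_apply, i1, i2, i3, i4, neg_neg]
    · linear_combination h + hd
    · exact h01.symm
    · exact h10.symm
    · linear_combination h - hd

variable [DecidableEq F]

open Classical in
lemma card_centralizer_le [Fintype F] (h2 : (2 : F) ≠ 0) {g : SL(2, F)}
    (hg : g.1.trace ^ 2 ≠ 4) :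
    (Finset.univ.filter fun x => Commute g x).card ≤ 2 * Fintype.card F := by
  have hex : ∀ x : SL(2, F), ∃ s : F, Commute g x →
      x 0 1 = s * g 0 1 ∧ x 1 0 = s * g 1 0 ∧ x 1 1 - x 0 0 = s * (g 1 1 - g 0 0) := by
    intro x
    by_cases h : Commute g x
    · obtain ⟨s, hs⟩ := exists_factor_of_commute hg h
      exact ⟨s, fun _ => hs⟩
    · exact ⟨0, fun h' => absurd h' h⟩
  choose s hs using hex
  refine Finset.card_le_mul_card_image_of_maps_to (f := s) (t := Finset.univ)
    (fun _ _ => Finset.mem_univ _) 2 fun b _ => ?_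
  rcases Finset.eq_empty_or_nonempty
    ((Finset.univ.filter fun x => Commute g x).filter fun x => s x = b) with h | ⟨x, hx⟩
  · rw [h]; simp
  refine (Finset.card_le_card (t := {x, -x⁻¹}) ?_).trans Finset.card_le_two
  intro y hy
  simp only [Finset.mem_filter, Finset.mem_univ, true_and] at hx hy
  obtain ⟨x1, x2, x3⟩ := hs x hx.1
  obtain ⟨y1, y2, y3⟩ := hs y hy.1
  rw [hx.2] at x1 x2 x3
  rw [hy.2] at y1 y2 y3
  simpa using eq_or_eq_neg_inv_of_factor_eq h2 (x1.trans y1.symm) (x2.trans y2.symm)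
    (x3.trans y3.symm)

open Classical in
-- At most two conjugates of `g` lie in the torus of `v`, since they share a trace, and each arises
-- from one coset of the centralizer of `g`.
lemma card_conjugators_le [Fintype F] (h2 : (2 : F) ≠ 0) {g : SL(2, F)}
    (hg : g.1.trace ^ 2 ≠ 4) {v : SL(2, F)} (hv : ¬ (v = 1 ∨ v = -1)) :
    (Finset.univ.filter fun h => Commute (h * g * h⁻¹) v).card ≤ 4 * Fintype.card F := by
  set H := Finset.univ.filter fun h => Commute (h * g * h⁻¹) v with hH
  have hHm : ∀ h, h ∈ H ↔ Commute (h * g * h⁻¹) v := by simp [hH]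
  have himg : (H.image fun h => h * g * h⁻¹).card ≤ 2 := by
    rcases Finset.eq_empty_or_nonempty H with h0 | ⟨h₁, hh₁⟩
    · rw [h0]; simp
    rw [hHm] at hh₁
    have hvr : v.1.trace ^ 2 ≠ 4 :=
      trace_sq_ne_four_of_commute (by rw [trace_conj]; exact hg) hh₁ hv
    refine (Finset.card_le_card (t := {h₁ * g * h₁⁻¹, (h₁ * g * h₁⁻¹)⁻¹}) ?_).trans
      Finset.card_le_two
    intro y hy
    obtain ⟨h, hh, rfl⟩ := Finset.mem_image.1 hy
    rw [hHm] at hh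
    simpa only [Finset.mem_insert, Finset.mem_singleton] using
      eq_or_eq_inv_of_commute h2 hvr hh₁.symm hh.symm (by rw [trace_conj, trace_conj])
  have hfib : ∀ y ∈ H.image (fun h => h * g * h⁻¹),
      (H.filter fun h => h * g * h⁻¹ = y).card ≤ 2 * Fintype.card F := by
    intro y hy
    obtain ⟨h₀, _, rfl⟩ := Finset.mem_image.1 hy
    refine le_trans (Finset.card_le_card_of_injOn (fun h => h₀⁻¹ * h) ?_
      (by intro x _ y _ h; simpa using h)) (card_centralizer_le h2 hg)
    intro h hh
    simp only [Finset.coe_filter, Set.mem_ofPred_eq, Finset.mem_univ, true_and] at hh ⊢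
    have h' : h * g = h₀ * g * h₀⁻¹ * h := by rw [← hh.2]; group
    change g * (h₀⁻¹ * h) = h₀⁻¹ * h * g
    rw [mul_assoc h₀⁻¹ h g, h']; group
  have := Finset.card_le_mul_card_image H _ hfib
  calc _ ≤ _ := this
    _ ≤ 2 * Fintype.card F * 2 := Nat.mul_le_mul_left _ himg
    _ = _ := by ring

open Classical in
-- If `(b, v)` and `(b₀, v₀)` give the same product `b * a * v`, then `b₀⁻¹ * b` lies in `A ^ 2` and
-- centralizes `a * x * a⁻¹`, so it is `±1`. Fibres thus have at most two elements.
lemma card_mul_card_centralizer_le {A : Finset SL(2, F)} (hsymm : A⁻¹ = A) {x a : SL(2, F)}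
    (ha : a ∈ A) (h : ∀ w ∈ A ^ 2, Commute (a * x * a⁻¹) w → w = 1 ∨ w = -1) :
    A.card * ((A ^ 2).filter fun v => Commute x v).card ≤ 2 * (A ^ 4).card := by
  rw [← Finset.card_product]
  refine Finset.card_le_mul_card_image_of_maps_to (f := fun t => t.1 * a * t.2) ?_ 2 ?_
  · rintro ⟨b, v⟩ ht
    rw [Finset.mem_product, Finset.mem_filter] at ht
    have hb : b ∈ A ^ 1 := by rw [pow_one]; exact ht.1
    have ha' : a ∈ A ^ 1 := by rw [pow_one]; exact ha
    exact mem_pow_add (m := 2) (n := 2) (mem_pow_add hb ha') ht.2.1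
  · intro y _
    rcases Finset.eq_empty_or_nonempty ((A ×ˢ ((A ^ 2).filter fun v => Commute x v)).filter
      fun t => t.1 * a * t.2 = y) with h0 | ⟨⟨b₀, v₀⟩, h₀⟩
    · rw [h0]; simp
    refine (Finset.card_le_card (t := {(b₀, v₀), (-b₀, -v₀)}) ?_).trans Finset.card_le_two
    rintro ⟨b, v⟩ ht
    simp only [Finset.mem_filter, Finset.mem_product] at ht h₀
    obtain ⟨⟨hb, hv, hxv⟩, hy⟩ := ht
    obtain ⟨⟨hb₀, hv₀, hxv₀⟩, hy₀⟩ := h₀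
    have heq : b * a * v = b₀ * a * v₀ := hy.trans hy₀.symm
    have hw : b₀⁻¹ * b = a * (v₀ * v⁻¹) * a⁻¹ := by
      have : b = b₀ * a * v₀ * v⁻¹ * a⁻¹ := by rw [← heq]; group
      rw [this]; group
    have hmem : b₀⁻¹ * b ∈ A ^ 2 := by
      rw [pow_two]
      refine Finset.mul_mem_mul ?_ hb
      rw [← hsymm]; exact Finset.inv_mem_inv hb₀
    have hcomm : Commute (a * x * a⁻¹) (b₀⁻¹ * b) := by
      rw [hw]
      have hc : Commute x (v₀ * v⁻¹) := hxv₀.mul_right hxv.inv_right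
      change _ = _
      calc a * x * a⁻¹ * (a * (v₀ * v⁻¹) * a⁻¹) = a * (x * (v₀ * v⁻¹)) * a⁻¹ := by group
        _ = a * ((v₀ * v⁻¹) * x) * a⁻¹ := by rw [hc.eq]
        _ = _ := by group
    simp only [Finset.mem_insert, Finset.mem_singleton, Prod.mk.injEq]
    rcases h _ hmem hcomm with h1 | h1
    · left
      have hbb : b = b₀ := (inv_mul_eq_one.1 h1).symm
      subst hbb
      exact ⟨rfl, mul_left_cancel heq⟩
    · right
      have hbb : b = -b₀ := by
        have := congrArg (fun z => b₀ * z) h1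
        simpa using this
      subst hbb
      refine ⟨rfl, ?_⟩
      have h3 : b₀ * a * (-v) = b₀ * a * v₀ := by rw [← heq]; simp
      rw [← mul_left_cancel h3, neg_neg]

end SL2

/-! ### The dimension bound for conjugacy classes, and regular elements in `A ^ 2`. -/

section SL2

variable {F : Type*} [Field F]

/-- The two quotients determine the triple `(u * x * u⁻¹, y, z)` up to a common right factor. That
factor preserves all three traces, so general position leaves at most two possibilities for it. -/
lemma card_triples_le [DecidableEq F] {A : Finset SL(2, F)} (hsymm : A⁻¹ = A) {τ : F} {n : ℕ}
    {S : Finset SL(2, F)} (hSA : S ⊆ A ^ n) (hSτ : ∀ x ∈ S, x.1.trace = τ) {u : SL(2, F)}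
    (hu : u ∈ A) {T : Finset (SL(2, F) × SL(2, F) × SL(2, F))}
    (hT : ∀ t ∈ T, t.1 ∈ S ∧ t.2.1 ∈ S ∧ t.2.2 ∈ S ∧
      GeneralPosition (u * t.1 * u⁻¹ : SL(2, F)).1 t.2.1.1 t.2.2.1) :
    T.card ≤ 2 * ((A ^ (n + 1 + n)).card * (A ^ (n + n)).card) := by
  rw [← Finset.card_product]
  refine Finset.card_le_mul_card_image_of_maps_to
    (f := fun t => (t.1 * u⁻¹ * t.2.1⁻¹, t.2.2 * t.2.1⁻¹)) ?_ 2 ?_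
  · intro t ht
    obtain ⟨hx, hy, hz, -⟩ := hT t ht
    have hy' := inv_mem_pow_of_symm hsymm (hSA hy)
    have hu' : u⁻¹ ∈ A ^ 1 := inv_mem_pow_of_symm hsymm (by rwa [pow_one])
    exact Finset.mem_product.2 ⟨mem_pow_add (mem_pow_add (hSA hx) hu') hy',
      mem_pow_add (hSA hz) hy'⟩
  · intro b _
    by_contra! hlt
    obtain ⟨t₀, h₀, t₁, h₁, t₂, h₂, h01, h02, h12⟩ := Finset.two_lt_card.1 hlt
    rw [Finset.mem_filter] at h₀ h₁ h₂
    obtain ⟨h₀T, rfl⟩ := h₀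
    obtain ⟨hx₀, hy₀, hz₀, hgp⟩ := hT t₀ h₀T
    have key : ∀ t ∈ T, (t.1 * u⁻¹ * t.2.1⁻¹, t.2.2 * t.2.1⁻¹) =
        (t₀.1 * u⁻¹ * t₀.2.1⁻¹, t₀.2.2 * t₀.2.1⁻¹) →
        u * t.1 * u⁻¹ = u * t₀.1 * u⁻¹ * (t₀.2.1⁻¹ * t.2.1) ∧
        t.2.1 = t₀.2.1 * (t₀.2.1⁻¹ * t.2.1) ∧ t.2.2 = t₀.2.2 * (t₀.2.1⁻¹ * t.2.1) := by
      intro t _ ht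
      simp only [Prod.mk.injEq] at ht
      obtain ⟨e1, e2⟩ := ht
      refine ⟨?_, by group, ?_⟩
      · calc u * t.1 * u⁻¹ = u * (t.1 * u⁻¹ * t.2.1⁻¹) * t.2.1 := by group
          _ = u * (t₀.1 * u⁻¹ * t₀.2.1⁻¹) * t.2.1 := by rw [e1]
          _ = _ := by group
      · calc t.2.2 = t.2.2 * t.2.1⁻¹ * t.2.1 := by group
          _ = t₀.2.2 * t₀.2.1⁻¹ * t.2.1 := by rw [e2]
          _ = _ := by group
    have key2 : ∀ t ∈ T, (t.1 * u⁻¹ * t.2.1⁻¹, t.2.2 * t.2.1⁻¹) =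
        (t₀.1 * u⁻¹ * t₀.2.1⁻¹, t₀.2.2 * t₀.2.1⁻¹) →
        ((u * t₀.1 * u⁻¹ : SL(2, F)).1 * (t₀.2.1⁻¹ * t.2.1 : SL(2, F)).1).trace =
          (u * t₀.1 * u⁻¹ : SL(2, F)).1.trace ∧
        (t₀.2.1.1 * (t₀.2.1⁻¹ * t.2.1 : SL(2, F)).1).trace = t₀.2.1.1.trace ∧
        (t₀.2.2.1 * (t₀.2.1⁻¹ * t.2.1 : SL(2, F)).1).trace = t₀.2.2.1.trace := by
      intro t htT ht
      obtain ⟨e1, e2, e3⟩ := key t htT ht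
      obtain ⟨hx, hy, hz, -⟩ := hT t htT
      refine ⟨?_, ?_, ?_⟩
      · rw [← Matrix.SpecialLinearGroup.coe_mul, ← e1, trace_conj, trace_conj, hSτ _ hx,
          hSτ _ hx₀]
      · rw [← Matrix.SpecialLinearGroup.coe_mul, ← e2, hSτ _ hy, hSτ _ hy₀]
      · rw [← Matrix.SpecialLinearGroup.coe_mul, ← e3, hSτ _ hz, hSτ _ hz₀]
    have key3 : ∀ t ∈ T, ∀ t' ∈ T, (t.1 * u⁻¹ * t.2.1⁻¹, t.2.2 * t.2.1⁻¹) =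
        (t₀.1 * u⁻¹ * t₀.2.1⁻¹, t₀.2.2 * t₀.2.1⁻¹) →
        (t'.1 * u⁻¹ * t'.2.1⁻¹, t'.2.2 * t'.2.1⁻¹) =
        (t₀.1 * u⁻¹ * t₀.2.1⁻¹, t₀.2.2 * t₀.2.1⁻¹) →
        t₀.2.1⁻¹ * t.2.1 = t₀.2.1⁻¹ * t'.2.1 → t = t' := by
      intro t htT t' ht'T ht ht' h
      obtain ⟨e1, e2, e3⟩ := key t htT ht
      obtain ⟨f1, f2, f3⟩ := key t' ht'T ht'
      rw [h, ← f1] at e1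
      rw [h, ← f2] at e2
      rw [h, ← f3] at e3
      exact Prod.ext (mul_left_cancel (mul_right_cancel e1)) (Prod.ext e2 e3)
    have hone : t₀.2.1⁻¹ * t₀.2.1 = 1 := inv_mul_cancel _
    obtain ⟨p1, p2, p3⟩ := key2 t₁ h₁.1 h₁.2
    obtain ⟨q1, q2, q3⟩ := key2 t₂ h₂.1 h₂.2
    refine h12 (key3 t₁ h₁.1 t₂ h₂.1 h₁.2 h₂.2 (hgp.eq_of_trace_eq ?_ ?_ p1 p2 p3 q1 q2 q3))
    · intro h
      exact h01 (key3 t₀ h₀T t₁ h₁.1 rfl h₁.2 (hone.trans h.symm))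
    · intro h
      exact h02 (key3 t₀ h₀T t₂ h₂.1 rfl h₂.2 (hone.trans h.symm))

lemma card_conj_cube_le [DecidableEq F] (h2 : (2 : F) ≠ 0) {A : Finset SL(2, F)}
    (hsymm : A⁻¹ = A) (h1 : 1 ∈ A) (hA : Subgroup.closure (A : Set SL(2, F)) = ⊤)
    {g : SL(2, F)} (hg : g ∈ A ^ 2) (hgr : g.1.trace ^ 2 ≠ 4) :
    (A.image fun a => a * g * a⁻¹).card ^ 3 ≤ 64 ^ 3 * ((A ^ 9).card * (A ^ 8).card) := by
  set S := A.image fun a => a * g * a⁻¹ with hS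
  have hSτ : ∀ x ∈ S, x.1.trace = g.1.trace := by
    intro x hx
    obtain ⟨a, _, rfl⟩ := Finset.mem_image.1 hx
    exact trace_conj a g
  have hSA : S ⊆ A ^ 4 := by
    intro x hx
    obtain ⟨a, ha, rfl⟩ := Finset.mem_image.1 hx
    have ha' : a ∈ A ^ 1 := by rwa [pow_one]
    exact mem_pow_add (m := 3) (n := 1) (mem_pow_add (m := 1) (n := 2) ha' hg)
      (inv_mem_pow_of_symm hsymm ha')
  by_cases hc : 64 ≤ S.card
  · obtain ⟨u, hu, k, T, hk, hT, hTm⟩ := hasManyTriples h2 hsymm hA S hgr hSτ hc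
    rw [Finset.insert_eq_of_mem h1] at hu
    have := card_triples_le hsymm hSA hSτ hu hTm
    calc S.card ^ 3 ≤ (16 * k) ^ 3 := Nat.pow_le_pow_left hk 3
      _ = 16 ^ 3 * k ^ 3 := by ring
      _ ≤ 16 ^ 3 * (2 * ((A ^ 9).card * (A ^ 8).card)) :=
        Nat.mul_le_mul_left _ (hT.trans this)
      _ = 8192 * ((A ^ 9).card * (A ^ 8).card) := by ring
      _ ≤ _ := Nat.mul_le_mul_right _ (by norm_num)
  · have hpos : ∀ n, 1 ≤ (A ^ n).card := fun n =>
      Finset.card_pos.2 (Finset.Nonempty.pow ⟨1, h1⟩)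
    calc S.card ^ 3 ≤ 64 ^ 3 := Nat.pow_le_pow_left (by omega) 3
      _ = 64 ^ 3 * (1 * 1) := by ring
      _ ≤ _ := Nat.mul_le_mul_left _ (Nat.mul_le_mul (hpos 9) (hpos 8))

lemma exists_not_commute {A : Set SL(2, F)} (hA : Subgroup.closure A = ⊤) :
    ∃ g ∈ A, ∃ h ∈ A, ¬ Commute g h := by
  by_contra! hcomm
  have h1 : A ⊆ Subgroup.centralizer A := by
    intro h hh
    rw [SetLike.mem_coe, Subgroup.mem_centralizer_iff]
    exact fun g hg => (hcomm g hg h hh).eq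
  have h2 : Subgroup.centralizer A = ⊤ := by
    rw [eq_top_iff, ← hA, Subgroup.closure_le]; exact h1
  have h3 : A ⊆ Subgroup.center SL(2, F) := by
    intro g hg
    rw [SetLike.mem_coe, Subgroup.mem_center_iff]
    intro z
    have : z ∈ Subgroup.centralizer A := h2 ▸ Subgroup.mem_top z
    exact (Subgroup.mem_centralizer_iff.1 this g hg).symm
  have h4 : (weyl : SL(2, F)) ∈ Subgroup.center SL(2, F) := by
    have : Subgroup.closure A ≤ Subgroup.center SL(2, F) := (Subgroup.closure_le _).2 h3
    exact this (hA ▸ Subgroup.mem_top _)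
  have h5 : Commute (upperUnip 1) (weyl : SL(2, F)) := Subgroup.mem_center_iff.1 h4 _
  have h6 := (commute_iff_entries.1 h5).1
  simp [upperUnip, weyl] at h6

/-- When the discriminant vanishes, the form is a multiple of the square of the linear form
vanishing at `a`. The two forms, and hence the trace-free parts, are proportional. -/
lemma commute_of_common_eigenvector {x y : SL(2, F)} (hx : x.1.trace ^ 2 = 4)
    (hy : y.1.trace ^ 2 = 4) {a : F × F} (ha : a ≠ 0) (hxa : eigenForm x.1 a = 0)
    (hya : eigenForm y.1 a = 0) : Commute x y := by
  obtain ⟨b, hb⟩ : ∃ b, cross a b ≠ 0 := by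
    by_contra! h
    apply ha
    have h1 := h (1, 0)
    have h2 := h (0, 1)
    simp only [cross, mul_zero, mul_one, zero_sub, sub_zero, neg_eq_zero] at h1 h2
    exact Prod.ext h2 h1
  have hform : ∀ z : SL(2, F), z.1.trace ^ 2 = 4 → eigenForm z.1 a = 0 → ∀ d,
      cross a b ^ 2 * eigenForm z.1 d = cross a d ^ 2 * eigenForm z.1 b := by
    intro z hz hza d
    have h1 := eigenPolar_sq z a b
    rw [hza, hz] at h1
    have h2 : eigenPolar z.1 a b = 0 := by
      have : eigenPolar z.1 a b ^ 2 = 0 := by linear_combination h1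
      exact (pow_eq_zero_iff two_ne_zero).1 this
    have h3 := cross_sq_mul_eigenForm z.1 a b d
    rw [hza, h2] at h3
    linear_combination h3
  have hx' := hform x hx hxa
  have hy' := hform y hy hya
  have hc2 : cross a b ^ 2 ≠ 0 := pow_ne_zero _ hb
  have hfe : ∀ (z : SL(2, F)), eigenForm z.1 (1, 0) = z 1 0 ∧ eigenForm z.1 (0, 1) = - z 0 1 ∧
      eigenForm z.1 (1, 1) - eigenForm z.1 (1, 0) - eigenForm z.1 (0, 1) = z 1 1 - z 0 0 := by
    intro z
    simp only [eigenForm]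
    refine ⟨by ring, by ring, by ring⟩
  obtain ⟨x1, x2, x3⟩ := hfe x
  obtain ⟨y1, y2, y3⟩ := hfe y
  have hc4 : cross a b ^ 2 * cross a b ^ 2 ≠ 0 := mul_ne_zero hc2 hc2
  rw [commute_iff_entries, ← x3, ← y3, ← x1, ← y1, ← neg_eq_iff_eq_neg.2 x2,
    ← neg_eq_iff_eq_neg.2 y2]
  have hpq : ∀ d e, eigenForm x.1 d * eigenForm y.1 e = eigenForm y.1 d * eigenForm x.1 e := by
    intro d e
    apply mul_left_cancel₀ hc4
    linear_combination cross a b ^ 2 * eigenForm y.1 e * hx' d +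
      cross a d ^ 2 * eigenForm x.1 b * hy' e - cross a b ^ 2 * eigenForm x.1 e * hy' d -
      cross a d ^ 2 * eigenForm y.1 b * hx' e
  refine ⟨?_, ?_, ?_⟩
  · linear_combination - hpq (0, 1) (1, 0)
  · linear_combination - hpq (0, 1) (1, 1) + hpq (0, 1) (1, 0)
      + hpq (0, 1) (0, 1)
  · linear_combination hpq (1, 0) (1, 1) - hpq (1, 0) (1, 0) - hpq (1, 0) (0, 1)

/-- Again a line meets the quadric `det = 1`. Were the line contained in it, its nilpotent direction
would give `g` and `h` a common eigenvector, and they would commute. -/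
lemma eq_of_trace_eq_of_not_commute {g h : SL(2, F)} (hg : g.1.trace ^ 2 = 4)
    (hh : h.1.trace ^ 2 = 4) (hgh : ¬ Commute g h) {x y z : SL(2, F)} (hxy : x ≠ y) (hxz : x ≠ z)
    (hy : y.1.trace = x.1.trace) (hgy : (g.1 * y.1).trace = (g.1 * x.1).trace)
    (hhy : (h.1 * y.1).trace = (h.1 * x.1).trace) (hz : z.1.trace = x.1.trace)
    (hgz : (g.1 * z.1).trace = (g.1 * x.1).trace)
    (hhz : (h.1 * z.1).trace = (h.1 * x.1).trace) : y = z := by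
  have hli : LinearIndependent F ![(1 : SL(2, F)).1, g.1, h.1] := by
    apply linearIndependent_triple' (SL2_ne_zero 1)
    · intro hmem
      apply hgh
      rcases eq_or_eq_neg_of_mem_span 1 g hmem with rfl | rfl
      · exact Commute.one_left _
      · exact Commute.neg_left (Commute.one_left _)
    · intro hmem
      apply hgh
      obtain ⟨c, d, hcd⟩ := Submodule.mem_span_pair.1 hmem
      apply Subtype.ext
      rw [Matrix.SpecialLinearGroup.coe_mul, Matrix.SpecialLinearGroup.coe_mul, ← hcd]
      simp [mul_add, add_mul]
  have key : ∀ (m y : Matrix (Fin 2) (Fin 2) F), (m * y).trace = (m * x.1).trace →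
      (m * (y - x.1)).trace = 0 := by
    intro m y h
    rw [mul_sub, Matrix.trace_sub, h, sub_self]
  have hne : ∀ w : SL(2, F), x ≠ w → w.1 - x.1 ≠ 0 := by
    intro w hw h0
    exact hw (Subtype.ext (sub_eq_zero.1 h0).symm)
  have hy1 := key (1 : SL(2, F)).1 y.1 (by simpa using hy)
  have hz1 := key (1 : SL(2, F)).1 z.1 (by simpa using hz)
  obtain ⟨t, ht⟩ := exists_smul_of_trace_mul_eq_zero hli (hne y hxy) hy1 (key _ _ hgy)
    (key _ _ hhy) hz1 (key _ _ hgz) (key _ _ hhz)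
  have hgy' := key _ _ hgy
  have hhy' := key _ _ hhy
  have hdx := SL2_det_eq x
  have hdy := SL2_det_eq y
  have hdz := SL2_det_eq z
  have hvne := hne y hxy
  have hwne := hne z hxz
  set v := y.1 - x.1 with hv
  have e1 : y.1 = x.1 + v := by rw [hv]; abel
  have e2 : z.1 = x.1 + t • v := by rw [← ht]; abel
  have ht0 : t ≠ 0 := by
    rintro rfl
    apply hwne
    rw [ht, zero_smul]
  rw [e1] at hdy
  rw [e2] at hdz
  simp only [Matrix.add_apply, Matrix.smul_apply, smul_eq_mul] at hdy hdz
  have h1 : t * ((t - 1) * (v 0 0 * v 1 1 - v 0 1 * v 1 0)) = 0 := by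
    linear_combination hdz - hdx - t * (hdy - hdx)
  rcases mul_eq_zero.1 ((mul_eq_zero.1 h1).resolve_left ht0) with h3 | h3
  · apply Subtype.ext
    rw [e1, e2, sub_eq_zero.1 h3, one_smul]
  · have htr : v 0 0 + v 1 1 = 0 := by
      rw [Matrix.SpecialLinearGroup.coe_one, one_mul, Matrix.trace_fin_two] at hy1
      exact hy1
    obtain ⟨a, ha, hx⟩ := exists_eigenvector_of_nilpotent hvne htr h3
    exact (hgh (commute_of_common_eigenvector hg hh ha (hx _ hgy') (hx _ hhy'))).elim

/-- Otherwise, for noncommuting `g` and `h` in `A`, the traces of `x`, `g * x`, `h * x` are all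
`±2`. They take at most 8 values, each attained at most twice, so `A` has at most 16 elements. -/
lemma exists_regular [DecidableEq F] {A : Finset SL(2, F)} (h1 : 1 ∈ A)
    (hA : Subgroup.closure (A : Set SL(2, F)) = ⊤) (hcard : 16 < A.card) :
    ∃ x ∈ A ^ 2, x.1.trace ^ 2 ≠ 4 := by
  by_contra! hall
  have hsub : ∀ a ∈ A, a ∈ A ^ 2 := by
    intro a ha
    rw [pow_two, ← one_mul a]
    exact Finset.mul_mem_mul h1 ha
  have hpm : ∀ x ∈ A ^ 2, x.1.trace ∈ ({2, -2} : Finset F) := by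
    intro x hx
    have h := hall x hx
    have : (x.1.trace - 2) * (x.1.trace + 2) = 0 := by linear_combination h
    rw [Finset.mem_insert, Finset.mem_singleton]
    rcases mul_eq_zero.1 this with h | h
    · exact Or.inl (sub_eq_zero.1 h)
    · exact Or.inr (eq_neg_of_add_eq_zero_left h)
  obtain ⟨g, hg, h, hh, hgh⟩ := exists_not_commute hA
  set E : Finset F := {2, -2} with hE
  have hEc : E.card ≤ 2 := Finset.card_le_two
  have hle := Finset.card_le_mul_card_image_of_maps_to (s := A) (t := E ×ˢ E ×ˢ E)
    (f := fun x => (x.1.trace, (g.1 * x.1).trace, (h.1 * x.1).trace)) (by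
      intro x hx
      rw [Finset.mem_product, Finset.mem_product]
      refine ⟨hpm x (hsub x hx), hpm (g * x) ?_, hpm (h * x) ?_⟩
      · rw [pow_two]; exact Finset.mul_mem_mul hg hx
      · rw [pow_two]; exact Finset.mul_mem_mul hh hx) 2 (by
      intro b _
      by_contra! hlt
      obtain ⟨x, hx, y, hy, z, hz, hxy, hxz, hyz⟩ := Finset.two_lt_card.1 hlt
      rw [Finset.mem_filter] at hx hy hz
      obtain ⟨-, rfl⟩ := hx
      simp only [Prod.mk.injEq] at hy hz
      exact hyz (eq_of_trace_eq_of_not_commute (hall g (hsub g hg)) (hall h (hsub h hh)) hgh hxy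
        hxz hy.2.1 hy.2.2.1 hy.2.2.2 hz.2.1 hz.2.2.1 hz.2.2.2))
  rw [Finset.card_product, Finset.card_product] at hle
  have : E.card * (E.card * E.card) ≤ 2 * (2 * 2) := Nat.mul_le_mul hEc (Nat.mul_le_mul hEc hEc)
  omega

end SL2

/-! ### The pivoting argument. -/

section Pivot

variable {F : Type*} [Field F] [DecidableEq F]

/-- The centralizer of `x` contains an element of `A ^ 2` other than `±1`. -/
def Involved (A : Finset SL(2, F)) (x : SL(2, F)) : Prop :=
  ∃ v ∈ A ^ 2, ¬ (v = 1 ∨ v = -1) ∧ Commute x v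

/-- Without a pivot, being involved passes from `x` to `a * x * a⁻¹` for each generator `a`, hence
to every conjugate of `g`. -/
lemma exists_pivot_or_forall_involved {A : Finset SL(2, F)} (hsymm : A⁻¹ = A)
    (hA : Subgroup.closure (A : Set SL(2, F)) = ⊤) {g : SL(2, F)} (hg : Involved A g) :
    (∃ x a, x.1.trace = g.1.trace ∧ a ∈ A ∧ Involved A x ∧ ¬ Involved A (a * x * a⁻¹)) ∨
      ∀ h : SL(2, F), Involved A (h * g * h⁻¹) := by
  by_contra! hcon
  obtain ⟨hstep, h, hh⟩ := hcon
  apply hh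
  have hmul : ∀ a ∈ A, ∀ y, Involved A (y * g * y⁻¹) → Involved A (a * y * g * (a * y)⁻¹) := by
    intro a ha y hy
    have := hstep (y * g * y⁻¹) a (trace_conj y g) ha hy
    convert this using 1
    group
  have hmem : h ∈ Subgroup.closure (A : Set SL(2, F)) := hA ▸ Subgroup.mem_top h
  induction hmem using Subgroup.closure_induction_left with
  | one => simpa using hg
  | mul_left a ha y _ ih => exact hmul a ha y (by by_contra h; exact absurd (ih h) h)
  | inv_mul_cancel a ha y _ ih =>
    refine hmul a⁻¹ ?_ y (by by_contra h; exact absurd (ih h) h)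
    rw [← hsymm]
    exact Finset.inv_mem_inv ha

open Classical in
-- Double counting of pairs `(h, v)` with `v` in `A ^ 2` other than `±1` commuting with `h * g *
-- h⁻¹`; discarding `±1` costs the 2.
lemma card_mul_le_of_forall_involved [Fintype F] (h2 : (2 : F) ≠ 0) {A : Finset SL(2, F)} {g : SL(2, F)}
    (hg : g.1.trace ^ 2 ≠ 4) {m : ℕ}
    (hm : ∀ h : SL(2, F), m ≤ ((A ^ 2).filter fun v => Commute (h * g * h⁻¹) v).card) :
    Fintype.card SL(2, F) * (m - 2) ≤ (A ^ 2).card * (4 * Fintype.card F) := by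
  set B := (A ^ 2).filter fun v => ¬ (v = 1 ∨ v = -1) with hB
  have hBle : B.card ≤ (A ^ 2).card := Finset.card_le_card (Finset.filter_subset _ _)
  refine le_trans ?_ (Nat.mul_le_mul_right _ hBle)
  rw [← Finset.card_univ]
  refine Finset.card_mul_le_card_mul (fun (h v : SL(2, F)) => Commute (h * g * h⁻¹) v) ?_ ?_
  · intro h _
    have h3 := card_filter_not_ge ((A ^ 2).filter fun v => Commute (h * g * h⁻¹) v)
      (fun v => v = 1 ∨ v = -1) (t := 2) (by
        refine (Finset.card_le_card (t := {1, -1}) ?_).trans Finset.card_le_two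
        intro v hv
        rw [Finset.mem_filter] at hv
        simpa using hv.2)
    have h4 := hm h
    have h5 : (((A ^ 2).filter fun v => Commute (h * g * h⁻¹) v).filter
        fun v => ¬ (v = 1 ∨ v = -1)) ⊆
        Finset.bipartiteAbove (fun (h v : SL(2, F)) => Commute (h * g * h⁻¹) v) B h := by
      intro v hv
      rw [Finset.mem_filter, Finset.mem_filter] at hv
      exact Finset.mem_filter.2 ⟨Finset.mem_filter.2 ⟨hv.1.1, hv.2⟩, hv.1.2⟩
    have h6 := Finset.card_le_card h5
    omega
  · intro v hv
    exact card_conjugators_le h2 hg (Finset.mem_filter.1 hv).2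

open Classical in
-- The element `x` need not lie in any bounded power of `A`, so orbit-stabilizer is applied to a
-- witness `v` in `A ^ 2`, whose centralizer lies in that of `x`.
lemma card_le_mul_of_involved {A : Finset SL(2, F)} (hsymm : A⁻¹ = A) {x : SL(2, F)}
    (hx : x.1.trace ^ 2 ≠ 4) (hi : Involved A x) :
    ∃ v ∈ A ^ 2, v.1.trace ^ 2 ≠ 4 ∧
      A.card ≤ ((A ^ 2).filter fun w => Commute x w).card *
        (A.image fun a => a * v * a⁻¹).card := by
  obtain ⟨v, hv, hv1, hxv⟩ := hi
  have hvr := trace_sq_ne_four_of_commute hx hxv hv1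
  refine ⟨v, hv, hvr, (card_le_card_centralizer_mul_card_conj hsymm v).trans ?_⟩
  refine Nat.mul_le_mul_right _ (Finset.card_le_card fun w hw => ?_)
  rw [Finset.mem_filter] at hw ⊢
  exact ⟨hw.1, commute_of_commute hvr hxv.symm hw.2⟩

lemma growth_alternative [Fintype F] (h2 : (2 : F) ≠ 0) {A : Finset SL(2, F)} (hsymm : A⁻¹ = A) (h1 : 1 ∈ A)
    (hA : Subgroup.closure (A : Set SL(2, F)) = ⊤) (hcard : 16 < A.card) :
    A.card ^ 6 ≤ 8 * (A ^ 4).card ^ 3 * (64 ^ 3 * ((A ^ 9).card * (A ^ 8).card)) ∨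
    A.card ^ 3 ≤ 64 * (64 ^ 3 * ((A ^ 9).card * (A ^ 8).card)) ∨
    (Fintype.card SL(2, F) * A.card) ^ 3 ≤ (8 * Fintype.card F * (A ^ 2).card) ^ 3 *
      (64 ^ 3 * ((A ^ 9).card * (A ^ 8).card)) := by
  classical
  set P := 64 ^ 3 * ((A ^ 9).card * (A ^ 8).card) with hP
  have hconj : ∀ v ∈ A ^ 2, v.1.trace ^ 2 ≠ 4 → (A.image fun a => a * v * a⁻¹).card ^ 3 ≤ P :=
    fun v hv hvr => card_conj_cube_le h2 hsymm h1 hA hv hvr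
  obtain ⟨g, hg, hgr⟩ := exists_regular h1 hA hcard
  have hgi : Involved A g := by
    refine ⟨g, hg, ?_, Commute.refl g⟩
    rintro (rfl | rfl) <;> apply hgr <;> simp <;> norm_num
  rcases exists_pivot_or_forall_involved hsymm hA hgi with ⟨x, a, hxg, ha, hx, hax⟩ | hall
  · left
    have hxr : x.1.trace ^ 2 ≠ 4 := by rwa [hxg]
    obtain ⟨v, hv, hvr, hle⟩ := card_le_mul_of_involved hsymm hxr hx
    have h4 := card_mul_card_centralizer_le hsymm ha (x := x) (by
      intro w hw hcw
      by_contra hne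
      exact hax ⟨w, hw, hne, hcw⟩)
    set V := ((A ^ 2).filter fun w => Commute x w).card with hV
    set s := (A.image fun a => a * v * a⁻¹).card with hs
    have hsP : s ^ 3 ≤ P := hconj v hv hvr
    have h5 : A.card ^ 2 ≤ 2 * (A ^ 4).card * s := by
      calc A.card ^ 2 = A.card * A.card := by ring
        _ ≤ A.card * (V * s) := Nat.mul_le_mul_left _ (by convert hle)
        _ = A.card * V * s := by ring
        _ ≤ _ := Nat.mul_le_mul_right _ (by convert h4)
    calc A.card ^ 6 = (A.card ^ 2) ^ 3 := by ring
      _ ≤ (2 * (A ^ 4).card * s) ^ 3 := Nat.pow_le_pow_left h5 3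
      _ = 8 * (A ^ 4).card ^ 3 * s ^ 3 := by ring
      _ ≤ _ := Nat.mul_le_mul_left _ hsP
  · right
    have hcr : ∀ h : SL(2, F), (h * g * h⁻¹ : SL(2, F)).1.trace ^ 2 ≠ 4 := fun h => by
      rwa [trace_conj]
    -- The poorest conjugate torus gives a lower bound valid for all of them, and orbit-stabilizer
    -- still applies to it.
    obtain ⟨h₀, _, hmin⟩ := Finset.exists_min_image Finset.univ
      (fun h : SL(2, F) => ((A ^ 2).filter fun v => Commute (h * g * h⁻¹) v).card)
      ⟨1, Finset.mem_univ 1⟩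
    obtain ⟨v, hv, hvr, hle⟩ := card_le_mul_of_involved hsymm (hcr h₀) (hall h₀)
    have hcount := card_mul_le_of_forall_involved h2 (A := A) hgr
      (m := ((A ^ 2).filter fun v => Commute (h₀ * g * h₀⁻¹) v).card)
      (fun h => by convert hmin h (Finset.mem_univ h))
    set m := ((A ^ 2).filter fun v => Commute (h₀ * g * h₀⁻¹) v).card with hmdef
    set s := (A.image fun a => a * v * a⁻¹).card with hs
    have hsP : s ^ 3 ≤ P := hconj v hv hvr
    have hle' : A.card ≤ m * s := by convert hle
    -- Beyond 4, the loss of `±1` is harmless, since `m ≤ 2 * (m - 2)`.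
    by_cases hm : m ≤ 4
    · left
      calc A.card ^ 3 ≤ (4 * s) ^ 3 :=
            Nat.pow_le_pow_left (hle'.trans (Nat.mul_le_mul_right _ hm)) 3
        _ = 64 * s ^ 3 := by ring
        _ ≤ _ := Nat.mul_le_mul_left _ hsP
    · right
      have h6 : Fintype.card SL(2, F) * A.card ≤ 8 * Fintype.card F * (A ^ 2).card * s := by
        calc Fintype.card SL(2, F) * A.card ≤ Fintype.card SL(2, F) * (2 * (m - 2) * s) :=
              Nat.mul_le_mul_left _ (hle'.trans (Nat.mul_le_mul_right _ (by omega)))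
          _ = 2 * (Fintype.card SL(2, F) * (m - 2)) * s := by ring
          _ ≤ 2 * ((A ^ 2).card * (4 * Fintype.card F)) * s :=
              Nat.mul_le_mul_right _ (Nat.mul_le_mul_left _ hcount)
          _ = _ := by ring
      calc (Fintype.card SL(2, F) * A.card) ^ 3 ≤ (8 * Fintype.card F * (A ^ 2).card * s) ^ 3 :=
            Nat.pow_le_pow_left h6 3
        _ = (8 * Fintype.card F * (A ^ 2).card) ^ 3 * s ^ 3 := by ring
        _ ≤ _ := Nat.mul_le_mul_left _ hsP

end Pivot

/-! ### Lower bound for dimensions of representations of `SL(2, ZMod p)`. -/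

section Representation

lemma upperUnip_add {F : Type*} [Field F] (s t : F) :
    upperUnip (s + t) = upperUnip s * upperUnip t := by
  apply SL2_ext <;> rw [SL2_mul_apply] <;> simp [upperUnip, add_comm]

lemma upperUnip_natCast {F : Type*} [Field F] (n : ℕ) :
    upperUnip (n : F) = upperUnip 1 ^ n := by
  induction n with
  | zero => rw [pow_zero]; apply SL2_ext <;> simp [upperUnip]
  | succ n ih => rw [Nat.cast_succ, upperUnip_add, ih, pow_succ]

/-- The diagonal element with entries `t, t⁻¹`. -/
def diagElt {F : Type*} [Field F] (t : Fˣ) : SL(2, F) :=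
  ⟨!![(t : F), 0; 0, ((t⁻¹ : Fˣ) : F)], by simp [Matrix.det_fin_two]⟩

lemma upperUnip_mul_diagElt {F : Type*} [Field F] (t : Fˣ) (r : F) :
    upperUnip ((t : F) ^ 2 * r) * diagElt t = diagElt t * upperUnip r := by
  apply SL2_ext <;> rw [SL2_mul_apply, SL2_mul_apply] <;> simp [upperUnip, diagElt]
  field_simp

lemma normal_eq_top_of_upperUnip_mem {p : ℕ} [Fact p.Prime] (N : Subgroup SL(2, ZMod p))
    [hN : N.Normal] (h : upperUnip 1 ∈ N) : N = ⊤ := by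
  have hU : ∀ t : ZMod p, upperUnip t ∈ N := by
    intro t
    rw [← ZMod.natCast_zmod_val t, upperUnip_natCast]
    exact N.pow_mem h _
  rw [eq_top_iff]
  intro g _
  refine Matrix.SL2.transvection_induction (fun g => g ∈ N) ?_ (fun A B => N.mul_mem) g
  intro i j hij c
  fin_cases i <;> fin_cases j
  · exact absurd rfl hij
  · convert hU c using 1
    apply SL2_ext <;> simp [upperUnip, Matrix.SpecialLinearGroup.transvection_coe]
  · have := hN.conj_mem _ (hU (-c)) weyl
    convert this using 1
    obtain ⟨i1, i2, i3, i4⟩ := SL2_inv_apply (weyl : SL(2, ZMod p))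
    apply SL2_ext <;> rw [SL2_mul_apply, SL2_mul_apply, SL2_mul_apply] <;>
      simp only [i1, i2, i3, i4] <;>
      simp [upperUnip, weyl, Matrix.SpecialLinearGroup.transvection_coe]
  · exact absurd rfl hij

variable {p : ℕ} [Fact p.Prime] {V : Type*} [AddCommGroup V] [Module ℂ V]

/-- The operator `U` of `upperUnip 1` is not the identity, since otherwise the whole group would act
trivially. An eigenvector is taken in the range of `U - 1`: eigenvalue 1 there would give `U v = v +
w`, hence `p • w = 0` from `U ^ p = 1`. -/
lemma exists_nontrivial_eigenvector [FiniteDimensional ℂ V] [Nontrivial V]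
    (ρ : Representation ℂ SL(2, ZMod p) V) (hinv : ∀ v, (∀ g, ρ g v = v) → v = 0) :
    ∃ (ζ : ℂ) (w : V), w ≠ 0 ∧ ρ (upperUnip 1) w = ζ • w ∧ ζ ≠ 1 ∧ ζ ^ p = 1 := by
  have hp0 : (p : ℂ) ≠ 0 := Nat.cast_ne_zero.2 (Fact.out : p.Prime).ne_zero
  set U := ρ (upperUnip 1) with hU
  have hUp : U ^ p = 1 := by
    rw [hU, ← map_pow, ← upperUnip_natCast, ZMod.natCast_self]
    rw [show (upperUnip 0 : SL(2, ZMod p)) = 1 by apply SL2_ext <;> simp [upperUnip], map_one]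
  have hU1 : U ≠ 1 := by
    intro h1
    have hker : ρ.ker = ⊤ := normal_eq_top_of_upperUnip_mem _ (by rw [MonoidHom.mem_ker]; exact h1)
    obtain ⟨v, hv⟩ := exists_ne (0 : V)
    apply hv
    apply hinv
    intro g
    have : g ∈ ρ.ker := hker ▸ Subgroup.mem_top g
    rw [MonoidHom.mem_ker] at this
    rw [this]; rfl
  let X := LinearMap.range (U - 1)
  have hXU : ∀ x ∈ X, U x ∈ X := by
    rintro _ ⟨v, rfl⟩
    refine ⟨U v, ?_⟩
    simp [map_sub]
  have hXne : Nontrivial X := by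
    rw [Submodule.nontrivial_iff_ne_bot]
    intro h
    exact hU1 (sub_eq_zero.1 (LinearMap.range_eq_bot.1 h))
  obtain ⟨ζ, hζ⟩ := Module.End.exists_eigenvalue (U.restrict hXU)
  obtain ⟨⟨w, hwX⟩, hw⟩ := hζ.exists_hasEigenvector
  have hw0 : w ≠ 0 := by
    intro h; exact hw.2 (Subtype.ext h)
  have hUw : U w = ζ • w := congrArg Subtype.val hw.apply_eq_smul
  have hpow : ∀ n : ℕ, (U ^ n) w = ζ ^ n • w := by
    intro n
    induction n with
    | zero => simp
    | succ n ih => rw [pow_succ', Module.End.mul_apply, ih, map_smul, hUw, smul_smul, pow_succ]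
  refine ⟨ζ, w, hw0, hUw, ?_, ?_⟩
  · rintro rfl
    rw [one_smul] at hUw
    obtain ⟨v, hv⟩ := hwX
    have hUv : U v = v + w := by rw [← hv]; simp
    have hn : ∀ n : ℕ, (U ^ n) v = v + (n : ℂ) • w := by
      intro n
      induction n with
      | zero => simp
      | succ n ih =>
        rw [pow_succ', Module.End.mul_apply, ih, map_add, map_smul, hUv, hUw, Nat.cast_succ,
          add_smul, one_smul]
        abel
    have h := hn p
    rw [hUp] at h
    have h' : (p : ℂ) • w = 0 := by simpa using h
    exact hw0 ((smul_eq_zero.1 h').resolve_left hp0)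
  · have h := hpow p
    rw [hUp] at h
    have h' : (ζ ^ p - 1) • w = 0 := by
      rw [sub_smul, ← h]; simp
    exact sub_eq_zero.1 ((smul_eq_zero.1 h').resolve_right hw0)

/-- Diagonal elements conjugate `upperUnip 1` to its powers with square exponent, so an eigenvalue
`ζ ≠ 1` brings along every `ζ ^ r` with `r` a nonzero square. These are distinct, and there are at
least `(p - 1) / 2` of them. -/
lemma sub_one_le_two_mul_finrank [FiniteDimensional ℂ V] [Nontrivial V]
    (ρ : Representation ℂ SL(2, ZMod p) V) (hinv : ∀ v, (∀ g, ρ g v = v) → v = 0) :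
    p - 1 ≤ 2 * Module.finrank ℂ V := by
  classical
  obtain ⟨ζ, w, hw, hUw, hζ1, hζp⟩ := exists_nontrivial_eigenvector ρ hinv
  have hprim : IsPrimitiveRoot ζ p := by
    rw [← orderOf_eq_prime hζp hζ1]; exact IsPrimitiveRoot.orderOf ζ
  have hpow : ∀ n : ℕ, (ρ (upperUnip 1) ^ n) w = ζ ^ n • w := by
    intro n
    induction n with
    | zero => simp
    | succ n ih => rw [pow_succ', Module.End.mul_apply, ih, map_smul, hUw, smul_smul, pow_succ]
  have hUr : ∀ r : ZMod p, ρ (upperUnip r) w = ζ ^ r.val • w := by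
    intro r
    conv_lhs => rw [← ZMod.natCast_zmod_val r]
    rw [upperUnip_natCast, map_pow, hpow]
  let R : Finset (ZMod p) := Finset.univ.image fun t : (ZMod p)ˣ => ((t⁻¹ : (ZMod p)ˣ) : ZMod p) ^ 2
  have hRcard : p - 1 ≤ 2 * R.card := by
    have hun : (Finset.univ : Finset (ZMod p)ˣ).card = p - 1 := by
      rw [Finset.card_univ, ZMod.card_units]
    rw [← hun]
    refine Finset.card_le_mul_card_image _ _ fun b hb => ?_
    obtain ⟨t₀, _, rfl⟩ := Finset.mem_image.1 hb
    refine (Finset.card_le_card (t := {t₀, -t₀}) ?_).trans Finset.card_le_two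
    intro t ht
    have h := (Finset.mem_filter.1 ht).2
    simp only [Finset.mem_insert, Finset.mem_singleton]
    rcases sq_eq_sq_iff_eq_or_eq_neg.1 h with h | h
    · left
      exact inv_injective (Units.ext h)
    · right
      have h' : t⁻¹ = -t₀⁻¹ := Units.ext (by rw [h, Units.val_neg])
      rw [← inv_inj, h', inv_neg]
  have hRex : ∀ r : R, ∃ t : (ZMod p)ˣ, ((t⁻¹ : (ZMod p)ˣ) : ZMod p) ^ 2 = r.1 := by
    rintro ⟨r, hr⟩
    obtain ⟨t, _, ht⟩ := Finset.mem_image.1 hr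
    exact ⟨t, ht⟩
  choose t ht using hRex
  have hinj : Function.Injective fun r : R => ζ ^ r.1.val := by
    intro r s hrs
    have := hprim.pow_inj (ZMod.val_lt r.1) (ZMod.val_lt s.1) hrs
    exact Subtype.ext (ZMod.val_injective p this)
  have hvec : ∀ r : R, Module.End.HasEigenvector (ρ (upperUnip 1)) (ζ ^ r.1.val) (ρ (diagElt (t r)) w) := by
    intro r
    rw [Module.End.hasEigenvector_iff, Module.End.mem_eigenspace_iff]
    constructor
    · rw [← Module.End.mul_apply, ← map_mul]
      have h1 : (1 : ZMod p) = ((t r : (ZMod p)ˣ) : ZMod p) ^ 2 * r.1 := by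
        rw [← ht r, ← mul_pow, Units.mul_inv, one_pow]
      have h2 : upperUnip 1 * diagElt (t r) = diagElt (t r) * upperUnip r.1 := by
        rw [← upperUnip_mul_diagElt, ← h1]
      rw [h2, map_mul, Module.End.mul_apply, hUr, map_smul]
    · intro h0
      apply hw
      have := congrArg (ρ (diagElt (t r))⁻¹) h0
      rwa [← Module.End.mul_apply, ← map_mul, inv_mul_cancel, map_one, Module.End.one_apply,
        map_zero] at this
  have hli := Module.End.eigenvectors_linearIndependent' _ _ hinj _ hvec
  have := hli.fintype_card_le_finrank
  rw [Fintype.card_coe] at this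
  omega

end Representation

/-! ### Spectral bound for convolution by a symmetric set. -/

section Quasirandom

variable {G : Type*} [Group G] [Fintype G]

/-- Right translation of functions on a finite group. -/
noncomputable def rightTranslation (G : Type*) [Group G] [Fintype G] :
    Representation ℂ G (EuclideanSpace ℂ G) where
  toFun g :=
    { toFun := fun f => WithLp.toLp 2 fun x => f (x * g)
      map_add' := fun f h => rfl
      map_smul' := fun c f => rfl }
  map_one' := by ext f x; simp
  map_mul' g h := by
    ext f x
    change f (x * (g * h)) = f (x * g * h)
    rw [mul_assoc]

lemma rightTranslation_apply (g : G) (f : EuclideanSpace ℂ G) (x : G) :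
    rightTranslation G g f x = f (x * g) := rfl

variable [DecidableEq G]

/-- Convolution with the balanced indicator function of `A`, as a matrix. -/
noncomputable def balancedMatrix (A : Finset G) : Matrix G G ℂ :=
  Matrix.of fun x y => (((if x * y⁻¹ ∈ A then 1 else 0) - A.card / Fintype.card G : ℝ) : ℂ)

lemma balancedMatrix_apply (A : Finset G) (x y : G) : balancedMatrix A x y =
    (((if x * y⁻¹ ∈ A then 1 else 0) - A.card / Fintype.card G : ℝ) : ℂ) := rfl

lemma isHermitian_balancedMatrix {A : Finset G} (hsymm : A⁻¹ = A) :
    (balancedMatrix A).IsHermitian := by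
  ext x y
  rw [Matrix.conjTranspose_apply, balancedMatrix_apply, balancedMatrix_apply, Complex.star_def,
    Complex.conj_ofReal]
  have : y * x⁻¹ ∈ A ↔ x * y⁻¹ ∈ A := by
    conv_lhs => rw [← hsymm, Finset.mem_inv']
    simp
  simp only [this]

lemma sum_indicator_mul_inv (A : Finset G) (y : G) :
    ∑ x, (if x * y⁻¹ ∈ A then (1 : ℝ) else 0) = A.card := by
  rw [← Equiv.sum_comp (Equiv.mulRight y)]
  simp

lemma sum_balancedMatrix (A : Finset G) (y : G) : ∑ x, balancedMatrix A x y = 0 := by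
  simp only [balancedMatrix_apply]
  rw [← Complex.ofReal_sum, Finset.sum_sub_distrib, sum_indicator_mul_inv]
  simp only [Finset.sum_const, Finset.card_univ, nsmul_eq_mul]
  rw [mul_div_cancel₀]
  · simp
  · exact Nat.cast_ne_zero.2 Fintype.card_ne_zero

lemma sum_norm_sq_balancedMatrix_le (A : Finset G) :
    ∑ y, ∑ x, ‖balancedMatrix A x y‖ ^ 2 ≤ Fintype.card G * A.card := by
  have h : ∀ y : G, ∑ x, ‖balancedMatrix A x y‖ ^ 2 ≤ A.card := by
    intro y
    have hn : (Fintype.card G : ℝ) ≠ 0 := Nat.cast_ne_zero.2 Fintype.card_ne_zero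
    have : ∀ x, ‖balancedMatrix A x y‖ ^ 2 = (if x * y⁻¹ ∈ A then (1 : ℝ) else 0) -
        2 * (A.card / Fintype.card G) * (if x * y⁻¹ ∈ A then (1 : ℝ) else 0) +
        (A.card / Fintype.card G) ^ 2 := by
      intro x
      rw [balancedMatrix_apply, Complex.norm_real, Real.norm_eq_abs, sq_abs]
      split_ifs <;> ring
    simp only [this]
    rw [Finset.sum_add_distrib, Finset.sum_sub_distrib, ← Finset.mul_sum, sum_indicator_mul_inv]
    simp only [Finset.sum_const, Finset.card_univ, nsmul_eq_mul]
    have h2 : (Fintype.card G : ℝ) * (A.card / Fintype.card G) ^ 2 =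
        A.card / Fintype.card G * A.card := by field_simp
    rw [h2]
    have : (0 : ℝ) ≤ A.card / Fintype.card G * A.card := by positivity
    linarith
  calc _ ≤ ∑ y : G, (A.card : ℝ) := Finset.sum_le_sum fun y _ => h y
    _ = _ := by simp

lemma toEuclideanLin_balancedMatrix_apply (A : Finset G) (f : EuclideanSpace ℂ G) (x : G) :
    (balancedMatrix A).toEuclideanLin f x = ∑ y, balancedMatrix A x y * f y := by
  rw [Matrix.toLpLin_apply]
  rfl

lemma balancedMatrix_rightTranslation (A : Finset G) (g : G) (f : EuclideanSpace ℂ G) :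
    (balancedMatrix A).toEuclideanLin (rightTranslation G g f) =
      rightTranslation G g ((balancedMatrix A).toEuclideanLin f) := by
  ext x
  rw [rightTranslation_apply, toEuclideanLin_balancedMatrix_apply,
    toEuclideanLin_balancedMatrix_apply,
    ← Equiv.sum_comp (Equiv.mulRight g) fun y => balancedMatrix A (x * g) y * f y]
  refine Finset.sum_congr rfl fun y _ => ?_
  rw [rightTranslation_apply, balancedMatrix_apply, balancedMatrix_apply]
  simp

lemma sum_toEuclideanLin_balancedMatrix (A : Finset G) (f : EuclideanSpace ℂ G) :
    ∑ x, (balancedMatrix A).toEuclideanLin f x = 0 := by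
  simp only [toEuclideanLin_balancedMatrix_apply]
  rw [Finset.sum_comm]
  simp only [← Finset.sum_mul, sum_balancedMatrix, zero_mul, Finset.sum_const_zero]

/-- The squared Hilbert-Schmidt norm is computed both in the eigenbasis and in the standard basis.
-/
lemma sum_eigenvalues_sq_le {A : Finset G} {n : ℕ}
    (hT : (balancedMatrix A).toEuclideanLin.IsSymmetric)
    (hn : Module.finrank ℂ (EuclideanSpace ℂ G) = n) :
    ∑ i, hT.eigenvalues hn i ^ 2 ≤ Fintype.card G * A.card := by
  set b := hT.eigenvectorBasis hn
  have h1 : ∀ i, hT.eigenvalues hn i ^ 2 =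
      ∑ y, ‖inner ℂ (b i) ((balancedMatrix A).toEuclideanLin (EuclideanSpace.single y 1))‖ ^ 2 := by
    intro i
    have h2 : ‖(balancedMatrix A).toEuclideanLin (b i)‖ ^ 2 = hT.eigenvalues hn i ^ 2 := by
      rw [hT.apply_eigenvectorBasis, norm_smul, b.norm_eq_one, mul_one]
      simp
    rw [← h2, EuclideanSpace.norm_sq_eq]
    refine Finset.sum_congr rfl fun y _ => ?_
    rw [← hT, EuclideanSpace.inner_single_right]
    simp
  simp only [h1]
  rw [Finset.sum_comm]
  refine le_trans (le_of_eq ?_) (sum_norm_sq_balancedMatrix_le A)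
  refine Finset.sum_congr rfl fun y _ => ?_
  rw [b.sum_sq_norm_inner_right, EuclideanSpace.norm_sq_eq]
  refine Finset.sum_congr rfl fun x _ => ?_
  rw [toEuclideanLin_balancedMatrix_apply]
  simp

lemma eigenvalue_sq_mul_finrank_le {A : Finset G} {n : ℕ}
    (hT : (balancedMatrix A).toEuclideanLin.IsSymmetric)
    (hn : Module.finrank ℂ (EuclideanSpace ℂ G) = n) (i : Fin n) :
    hT.eigenvalues hn i ^ 2 * Module.finrank ℂ (Module.End.eigenspace
      (balancedMatrix A).toEuclideanLin (hT.eigenvalues hn i : ℂ)) ≤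
      Fintype.card G * A.card := by
  refine le_trans ?_ (sum_eigenvalues_sq_le hT hn)
  have h := hT.card_filter_eigenvalues_eq hn (hT.eigenvalues hn i : ℂ)
  rw [← h]
  calc _ = ∑ j with (hT.eigenvalues hn j : ℂ) = hT.eigenvalues hn i,
        hT.eigenvalues hn i ^ 2 := by
        rw [Finset.sum_const, nsmul_eq_mul, mul_comm]; rfl
    _ = ∑ j with (hT.eigenvalues hn j : ℂ) = hT.eigenvalues hn i,
        hT.eigenvalues hn j ^ 2 := by
        refine Finset.sum_congr rfl fun j hj => ?_
        rw [Complex.ofReal_injective (Finset.mem_filter.1 hj).2]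
    _ ≤ _ := Finset.sum_le_sum_of_subset_of_nonneg (Finset.filter_subset _ _)
        fun _ _ _ => sq_nonneg _

/-- Convolution commutes with right translation, so the eigenspace is a representation. An invariant
vector is a constant function; it also has sum zero, because the image of the operator does, and so
it vanishes. -/
lemma sub_one_le_two_mul_finrank_eigenspace {p : ℕ} [Fact p.Prime]
    {A : Finset SL(2, ZMod p)} {μ : ℂ} (hμ : μ ≠ 0)
    (hne : Module.End.eigenspace (balancedMatrix A).toEuclideanLin μ ≠ ⊥) :
    p - 1 ≤ 2 * Module.finrank ℂ
      (Module.End.eigenspace (balancedMatrix A).toEuclideanLin μ) := by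
  set T := (balancedMatrix A).toEuclideanLin with hT
  set E := Module.End.eigenspace T μ with hE
  have hEm : ∀ f, f ∈ E ↔ T f = μ • f := fun f => Module.End.mem_eigenspace_iff
  have hEinv : ∀ g, ∀ f ∈ E, rightTranslation _ g f ∈ E := by
    intro g f hf
    rw [hEm] at hf ⊢
    rw [hT, balancedMatrix_rightTranslation, ← hT, hf, map_smul]
  let ρ : Representation ℂ SL(2, ZMod p) E :=
    { toFun := fun g => (rightTranslation _ g).restrict (hEinv g)
      map_one' := by
        ext f : 2
        simp
      map_mul' := by
        intro g h
        ext f : 2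
        simp }
  have : Nontrivial E := Submodule.nontrivial_iff_ne_bot.2 hne
  refine sub_one_le_two_mul_finrank ρ ?_
  rintro ⟨f, hf⟩ hfix
  have hconst : ∀ g, f g = f 1 := by
    intro g
    have := congrArg (fun h => h.1 1) (hfix g)
    simpa [ρ, rightTranslation_apply] using this
  have hsum : ∑ x, f x = 0 := by
    have h1 := sum_toEuclideanLin_balancedMatrix A f
    rw [← hT, (hEm f).1 hf] at h1
    simp only [PiLp.smul_apply, smul_eq_mul, ← Finset.mul_sum] at h1
    exact (mul_eq_zero.1 h1).resolve_left hμ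
  simp only [hconst, Finset.sum_const, Finset.card_univ, nsmul_eq_mul] at hsum
  have h1 : f 1 = 0 := (mul_eq_zero.1 hsum).resolve_left
    (Nat.cast_ne_zero.2 Fintype.card_ne_zero)
  ext g
  simpa [hconst g] using h1

/-- High multiplicity makes every eigenvalue small, since the squares of all eigenvalues have a
bounded sum. -/
lemma norm_sq_balancedMatrix_le {p : ℕ} [Fact p.Prime] {A : Finset SL(2, ZMod p)}
    (hsymm : A⁻¹ = A) (f : EuclideanSpace ℂ SL(2, ZMod p)) :
    ((p : ℝ) - 1) * ‖(balancedMatrix A).toEuclideanLin f‖ ^ 2 ≤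
      2 * (Fintype.card SL(2, ZMod p) * A.card) * ‖f‖ ^ 2 := by
  have hT : (balancedMatrix A).toEuclideanLin.IsSymmetric :=
    Matrix.isSymmetric_toEuclideanLin_iff.2 (isHermitian_balancedMatrix hsymm)
  set T := (balancedMatrix A).toEuclideanLin
  set b := hT.eigenvectorBasis rfl
  have hp : (1 : ℝ) ≤ p := by exact_mod_cast (Fact.out : p.Prime).one_le
  have hev : ∀ i, ((p : ℝ) - 1) * hT.eigenvalues rfl i ^ 2 ≤
      2 * (Fintype.card SL(2, ZMod p) * A.card) := by
    intro i
    by_cases h0 : hT.eigenvalues rfl i = 0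
    · rw [h0]; simp; positivity
    · have h1 : p - 1 ≤ 2 * Module.finrank ℂ (Module.End.eigenspace T
          (hT.eigenvalues rfl i : ℂ)) := sub_one_le_two_mul_finrank_eigenspace (A := A)
        (μ := (hT.eigenvalues rfl i : ℂ)) (by exact_mod_cast h0)
        (hT.hasEigenvalue_eigenvalues rfl i)
      have h2 := eigenvalue_sq_mul_finrank_le hT rfl i
      have h3 : (p : ℝ) - 1 ≤ 2 * Module.finrank ℂ (Module.End.eigenspace T
          (hT.eigenvalues rfl i : ℂ)) := by
        rw [sub_le_iff_le_add]
        have : p ≤ 2 * Module.finrank ℂ (Module.End.eigenspace T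
          (hT.eigenvalues rfl i : ℂ)) + 1 := by omega
        exact_mod_cast this
      nlinarith [sq_nonneg (hT.eigenvalues rfl i)]
  rw [← b.sum_sq_norm_inner_right (T f), ← b.sum_sq_norm_inner_right f, Finset.mul_sum,
    Finset.mul_sum]
  refine Finset.sum_le_sum fun i _ => ?_
  have : inner ℂ (b i) (T f) = hT.eigenvalues rfl i * inner ℂ (b i) f := by
    rw [← hT, hT.apply_eigenvectorBasis, inner_smul_left]
    simp [b]
  rw [this, norm_mul, mul_pow, Complex.norm_real, Real.norm_eq_abs, sq_abs, ← mul_assoc]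
  exact mul_le_mul_of_nonneg_right (hev i) (sq_nonneg _)

end Quasirandom

/-! ### Consequences for products of large sets, and the order of the group. -/

section Growth

variable {G : Type*} [Group G] [DecidableEq G]

/-- The number of representations of `x` as a product of two elements of `A`. -/
def repCount (A : Finset G) (x : G) : ℝ := ∑ y ∈ A, if x * y⁻¹ ∈ A then 1 else 0

lemma repCount_eq_zero {A : Finset G} {x : G} (hx : x ∉ A ^ 2) : repCount A x = 0 := by
  refine Finset.sum_eq_zero fun y hy => if_neg fun h => hx ?_
  have := Finset.mul_mem_mul h hy
  rwa [← pow_two, inv_mul_cancel_right] at this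

lemma sum_repCount [Fintype G] (A : Finset G) : ∑ x, repCount A x = (A.card : ℝ) ^ 2 := by
  unfold repCount
  rw [Finset.sum_comm]
  simp only [sum_indicator_mul_inv, Finset.sum_const, nsmul_eq_mul]
  ring

/-- The balanced operator sends the indicator of `A` to `repCount A` minus its mean. -/
lemma sum_sq_repCount_sub_le {p : ℕ} [Fact p.Prime] {A : Finset SL(2, ZMod p)}
    (hsymm : A⁻¹ = A) :
    ((p : ℝ) - 1) * ∑ x, (repCount A x - (A.card : ℝ) ^ 2 / Fintype.card SL(2, ZMod p)) ^ 2 ≤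
      2 * (Fintype.card SL(2, ZMod p) * (A.card : ℝ) ^ 2) := by
  let f : EuclideanSpace ℂ SL(2, ZMod p) := WithLp.toLp 2 fun x => if x ∈ A then 1 else 0
  have h := norm_sq_balancedMatrix_le hsymm f
  have hf : ‖f‖ ^ 2 = A.card := by
    rw [EuclideanSpace.norm_sq_eq]
    have : ∀ x, ‖f x‖ ^ 2 = if x ∈ A then (1 : ℝ) else 0 := by
      intro x
      by_cases hx : x ∈ A <;> simp [f, hx]
    simp [this]
  have hT : ∀ x, ‖(balancedMatrix A).toEuclideanLin f x‖ ^ 2 =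
      (repCount A x - (A.card : ℝ) ^ 2 / Fintype.card SL(2, ZMod p)) ^ 2 := by
    intro x
    have : (balancedMatrix A).toEuclideanLin f x =
        ((repCount A x - (A.card : ℝ) ^ 2 / Fintype.card SL(2, ZMod p) : ℝ) : ℂ) := by
      rw [toEuclideanLin_balancedMatrix_apply]
      have h1 : ∀ y, balancedMatrix A x y * f y =
          if y ∈ A then balancedMatrix A x y else 0 := by
        intro y
        by_cases hy : y ∈ A <;> simp [f, hy]
      simp only [h1]
      rw [Finset.sum_ite_mem, Finset.univ_inter]
      simp only [balancedMatrix_apply]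
      rw [← Complex.ofReal_sum, Finset.sum_sub_distrib, repCount]
      simp only [Finset.sum_const, nsmul_eq_mul]
      congr 2
      ring
    rw [this, Complex.norm_real, Real.norm_eq_abs, sq_abs]
  rw [hf, EuclideanSpace.norm_sq_eq] at h
  simp only [hT] at h
  refine h.trans (le_of_eq ?_)
  ring

/-- If `g` is missing from `A ^ 3`, then `repCount A` vanishes on the whole translate of `A` by `g`,
and these points alone contribute a large deviation from the mean. -/
lemma card_cube_le_of_pow_three_ne_univ {p : ℕ} [Fact p.Prime] {A : Finset SL(2, ZMod p)}
    (hsymm : A⁻¹ = A) (hA : A ^ 3 ≠ Finset.univ) :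
    ((p : ℝ) - 1) * (A.card : ℝ) ^ 3 ≤ 2 * (Fintype.card SL(2, ZMod p) : ℝ) ^ 3 := by
  obtain ⟨g, hg⟩ : ∃ g, g ∉ A ^ 3 := by
    by_contra! h
    exact hA (Finset.eq_univ_iff_forall.2 h)
  have hn : (0 : ℝ) < Fintype.card SL(2, ZMod p) := Nat.cast_pos.2 Fintype.card_pos
  have hp : (1 : ℝ) ≤ p := by exact_mod_cast (Fact.out : p.Prime).one_le
  have h0 : ∀ x ∈ A.image fun a => g * a, repCount A x = 0 := by
    intro x hx
    obtain ⟨a, ha, rfl⟩ := Finset.mem_image.1 hx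
    apply repCount_eq_zero
    intro hmem
    apply hg
    have ha' : a⁻¹ ∈ A ^ 1 := inv_mem_pow_of_symm hsymm (by rwa [pow_one])
    have := mem_pow_add hmem ha'
    simpa using this
  have h := sum_sq_repCount_sub_le hsymm
  have hcard : (A.image fun a => g * a).card = A.card :=
    Finset.card_image_of_injective _ (mul_right_injective g)
  have h1 : (A.card : ℝ) * ((A.card : ℝ) ^ 2 / Fintype.card SL(2, ZMod p)) ^ 2 ≤
      ∑ x, (repCount A x - (A.card : ℝ) ^ 2 / Fintype.card SL(2, ZMod p)) ^ 2 := by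
    calc _ = ∑ x ∈ A.image fun a => g * a,
          (repCount A x - (A.card : ℝ) ^ 2 / Fintype.card SL(2, ZMod p)) ^ 2 := by
          rw [Finset.sum_congr rfl fun x hx => by rw [h0 x hx], Finset.sum_const, hcard,
            nsmul_eq_mul]
          ring
      _ ≤ _ := Finset.sum_le_sum_of_subset_of_nonneg (Finset.subset_univ _)
          fun _ _ _ => sq_nonneg _
  have h2 := (mul_le_mul_of_nonneg_left h1 (sub_nonneg.2 hp)).trans h
  rcases (Nat.cast_nonneg (α := ℝ) A.card).eq_or_lt with ha | ha
  · rw [← ha]; simp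
  have h3 : ((p : ℝ) - 1) * (A.card : ℝ) ^ 3 * (A.card : ℝ) ^ 2 ≤
      2 * (Fintype.card SL(2, ZMod p) : ℝ) ^ 3 * (A.card : ℝ) ^ 2 := by
    have h4 := mul_le_mul_of_nonneg_right h2 (sq_nonneg (Fintype.card SL(2, ZMod p) : ℝ))
    have h5 : ((p : ℝ) - 1) * (A.card * ((A.card : ℝ) ^ 2 / Fintype.card SL(2, ZMod p)) ^ 2) *
        (Fintype.card SL(2, ZMod p) : ℝ) ^ 2 =
        ((p : ℝ) - 1) * (A.card : ℝ) ^ 3 * (A.card : ℝ) ^ 2 := by field_simp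
    rw [h5] at h4
    linarith
  exact le_of_mul_le_mul_right h3 (by positivity)

/-- Cauchy-Schwarz on `A ^ 2`, which carries all the mass of `repCount A`: if it occupies less than
half of the group, the deviation from the mean has sum at least `A.card ^ 2 / 2` there. -/
lemma card_sq_le_or_card_le {p : ℕ} [Fact p.Prime] {A : Finset SL(2, ZMod p)}
    (hsymm : A⁻¹ = A) :
    ((p : ℝ) - 1) * (A.card : ℝ) ^ 2 ≤
      8 * ((A ^ 2).card * Fintype.card SL(2, ZMod p)) ∨
    (Fintype.card SL(2, ZMod p) : ℝ) ≤ 2 * (A ^ 2).card := by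
  by_cases hbig : (Fintype.card SL(2, ZMod p) : ℝ) ≤ 2 * (A ^ 2).card
  · exact Or.inr hbig
  left
  push Not at hbig
  set n := (Fintype.card SL(2, ZMod p) : ℝ) with hndef
  have hn : (0 : ℝ) < n := Nat.cast_pos.2 Fintype.card_pos
  have hp : (1 : ℝ) ≤ p := by exact_mod_cast (Fact.out : p.Prime).one_le
  have h := sum_sq_repCount_sub_le hsymm
  rw [← hndef] at h
  set c : ℝ := (A.card : ℝ) ^ 2 / n with hc
  have hc0 : 0 ≤ c := by positivity
  have hsum : ∑ x ∈ A ^ 2, (repCount A x - c) = (A.card : ℝ) ^ 2 - (A ^ 2).card * c := by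
    rw [Finset.sum_sub_distrib, Finset.sum_const, nsmul_eq_mul, ← sum_repCount A]
    congr 1
    exact Finset.sum_subset (Finset.subset_univ _) fun x _ hx => repCount_eq_zero hx
  have hcs := sq_sum_le_card_mul_sum_sq (s := A ^ 2) (f := fun x => repCount A x - c)
  rw [hsum] at hcs
  have hle : ∑ x ∈ A ^ 2, (repCount A x - c) ^ 2 ≤ ∑ x, (repCount A x - c) ^ 2 :=
    Finset.sum_le_sum_of_subset_of_nonneg (Finset.subset_univ _) fun _ _ _ => sq_nonneg _
  have hcn : c * n = (A.card : ℝ) ^ 2 := by rw [hc]; field_simp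
  have hhalf : (A.card : ℝ) ^ 2 / 2 ≤ (A.card : ℝ) ^ 2 - (A ^ 2).card * c := by
    nlinarith
  have hsq : ((A.card : ℝ) ^ 2 / 2) ^ 2 ≤ ((A.card : ℝ) ^ 2 - (A ^ 2).card * c) ^ 2 :=
    pow_le_pow_left₀ (by positivity) hhalf 2
  have hm : (0 : ℝ) ≤ (A ^ 2).card := Nat.cast_nonneg _
  have key : ((p : ℝ) - 1) * ((A.card : ℝ) ^ 2 / 2) ^ 2 ≤
      (A ^ 2).card * (2 * (n * (A.card : ℝ) ^ 2)) := by
    calc ((p : ℝ) - 1) * ((A.card : ℝ) ^ 2 / 2) ^ 2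
        ≤ ((p : ℝ) - 1) * ((A ^ 2).card * ∑ x, (repCount A x - c) ^ 2) :=
          mul_le_mul_of_nonneg_left
            (hsq.trans (hcs.trans (mul_le_mul_of_nonneg_left hle hm))) (sub_nonneg.2 hp)
      _ = (A ^ 2).card * (((p : ℝ) - 1) * ∑ x, (repCount A x - c) ^ 2) := by ring
      _ ≤ _ := mul_le_mul_of_nonneg_left h hm
  rcases (Nat.cast_nonneg (α := ℝ) A.card).eq_or_lt with ha | ha
  · rw [← ha]; simp; positivity
  have ha2 : (0 : ℝ) < (A.card : ℝ) ^ 2 := by positivity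
  refine le_of_mul_le_mul_right ?_ ha2
  nlinarith

lemma card_SL2_le (p : ℕ) [Fact p.Prime] : Fintype.card SL(2, ZMod p) ≤ p ^ 3 := by
  let f : SL(2, ZMod p) → ZMod p × ZMod p × ZMod p := fun x =>
    (x 0 0, x 0 1, if x 0 1 = 0 then x 1 0 else x 1 1)
  have hf : Function.Injective f := by
    intro x y h
    simp only [f, Prod.mk.injEq] at h
    obtain ⟨h1, h2, h3⟩ := h
    have dx := SL2_det_eq x
    have dy := SL2_det_eq y
    rw [← h1, ← h2] at dy
    by_cases h0 : x 0 1 = 0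
    · rw [← h2, if_pos h0, if_pos h0] at h3
      rw [h0, zero_mul, sub_zero] at dx dy
      have hx0 : x 0 0 ≠ 0 := left_ne_zero_of_mul_eq_one dx
      exact SL2_ext h1 h2 h3 (mul_left_cancel₀ hx0 (dx.trans dy.symm))
    · rw [← h2, if_neg h0, if_neg h0] at h3
      rw [← h3] at dy
      exact SL2_ext h1 h2 (mul_left_cancel₀ h0 (by linear_combination dy - dx)) h3
  have := Fintype.card_le_of_injective f hf
  rw [Fintype.card_prod, Fintype.card_prod, ZMod.card] at this
  calc _ ≤ _ := this
    _ = p ^ 3 := by ring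

lemma le_card_SL2 (p : ℕ) [Fact p.Prime] : (p - 1) * p ^ 2 ≤ Fintype.card SL(2, ZMod p) := by
  let f : (ZMod p)ˣ × ZMod p × ZMod p → SL(2, ZMod p) := fun t =>
    ⟨!![(t.1 : ZMod p), t.2.1; t.2.2, (t.1⁻¹ : (ZMod p)ˣ) * (1 + t.2.1 * t.2.2)], by
      rw [Matrix.det_fin_two_of, ← mul_assoc, Units.mul_inv]; ring⟩
  have hf : Function.Injective f := by
    rintro ⟨a, b, c⟩ ⟨a', b', c'⟩ h
    have h00 := congrArg (fun m : SL(2, ZMod p) => m 0 0) h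
    have h01 := congrArg (fun m : SL(2, ZMod p) => m 0 1) h
    have h10 := congrArg (fun m : SL(2, ZMod p) => m 1 0) h
    simp only [f, Matrix.of_apply, Matrix.cons_val', Matrix.cons_val_zero, Matrix.cons_val_one,
      Matrix.cons_val_fin_one] at h00 h01 h10
    rw [Units.ext h00, h01, h10]
  have := Fintype.card_le_of_injective f hf
  rw [Fintype.card_prod, Fintype.card_prod, ZMod.card, ZMod.card_units] at this
  calc _ = _ := by ring
    _ ≤ _ := this

end Growth

/-! ### Assembling the bounds under small tripling. -/

section Growth

lemma card_insert_one_pow_three_le {G : Type*} [Group G] [DecidableEq G] {A : Finset G}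
    (hA : A.Nonempty) : (insert 1 A ^ 3).card ≤ 4 * (A ^ 3).card := by
  have hsub : insert 1 A ^ 3 ⊆ A ^ 3 ∪ A ^ 2 ∪ (A ^ 1 ∪ {1}) := by
    intro x hx
    rw [pow_succ, pow_two] at hx
    obtain ⟨y, hy, c, hc, rfl⟩ := Finset.mem_mul.1 hx
    obtain ⟨a, ha, b, hb, rfl⟩ := Finset.mem_mul.1 hy
    have h1 : ∀ {z}, z ∈ A → z ∈ A ^ 1 := fun h => by rwa [pow_one]
    have h2 : ∀ {z w}, z ∈ A → w ∈ A → z * w ∈ A ^ 2 := fun h h' => mem_pow_add (h1 h) (h1 h')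
    simp only [Finset.mem_union, Finset.mem_singleton]
    rcases Finset.mem_insert.1 ha with rfl | ha <;> rcases Finset.mem_insert.1 hb with rfl | hb <;>
      rcases Finset.mem_insert.1 hc with rfl | hc <;>
      try simp only [one_mul, mul_one]
    · exact Or.inr (Or.inr trivial)
    · exact Or.inr (Or.inl (h1 hc))
    · exact Or.inr (Or.inl (h1 hb))
    · exact Or.inl (Or.inr (h2 hb hc))
    · exact Or.inr (Or.inl (h1 ha))
    · exact Or.inl (Or.inr (h2 ha hc))
    · exact Or.inl (Or.inr (h2 ha hb))
    · exact Or.inl (Or.inl (mem_pow_add (h2 ha hb) (h1 hc)))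
  have h1 := Finset.card_le_card hsub
  have h2 := Finset.card_union_le (A ^ 3 ∪ A ^ 2) (A ^ 1 ∪ {1})
  have h3 := Finset.card_union_le (A ^ 3) (A ^ 2)
  have h4 := Finset.card_union_le (A ^ 1) {1}
  have h5 : (A ^ 2).card ≤ (A ^ 3).card := Finset.card_pow_mono (by norm_num) (by norm_num)
  have h6 : (A ^ 1).card ≤ (A ^ 3).card := Finset.card_pow_mono (by norm_num) (by norm_num)
  have h7 : 1 ≤ (A ^ 3).card := Finset.card_pos.2 hA.pow
  rw [Finset.card_singleton] at h4
  omega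

/-- If a generating set `A` has small tripling, then either `A` is small, or `p ^ 3` is at
most `A.card` up to a power of the tripling constant. -/
lemma card_le_or_pow_six_le {p : ℕ} [Fact p.Prime] {A : Finset SL(2, ZMod p)} (hsymm : A⁻¹ = A)
    (h1 : 1 ∈ A) (hA : Subgroup.closure (A : Set SL(2, ZMod p)) = ⊤) (hcard : 16 < A.card)
    {L : ℝ} (hL : 1 ≤ L) (hL3 : ((A ^ 3).card : ℝ) ≤ L * A.card) :
    (A.card : ℝ) ≤ 2 ^ 39 * L ^ 19 ∨ (p : ℝ) ^ 6 ≤ 2 ^ 30 * L ^ 16 * (A.card : ℝ) ^ 2 := by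
  -- For `p = 2` the group has at most 8 elements, fewer than `A`.
  have hp2 : p ≠ 2 := by
    rintro rfl
    have h := card_SL2_le 2
    have := Finset.card_le_univ A
    omega
  have h2 : (2 : ZMod p) ≠ 0 := by
    intro h
    have h' : ((2 : ℕ) : ZMod p) = 0 := by exact_mod_cast h
    rw [ZMod.natCast_eq_zero_iff] at h'
    exact hp2 ((Nat.prime_dvd_prime_iff_eq (Fact.out : p.Prime) Nat.prime_two).1 h')
  have hpow : ∀ m, 3 ≤ m → ((A ^ m).card : ℝ) ≤ L ^ (m - 2) * A.card := fun m hm =>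
    Finset.small_pow_of_small_tripling hm hL3 hsymm
  set b : ℝ := (A.card : ℝ) with hb
  have hb0 : 0 < b := by rw [hb]; exact_mod_cast (by omega : 0 < A.card)
  have h4 := hpow 4 (by norm_num)
  have h8 := hpow 8 (by norm_num)
  have h9 := hpow 9 (by norm_num)
  norm_num at h4 h8 h9
  have hq2 : ((A ^ 2).card : ℝ) ≤ L * b := by
    refine le_trans ?_ hL3
    exact_mod_cast Finset.card_pow_mono (s := A) (by norm_num) (by norm_num)
  have hL0 : 0 ≤ L := zero_le_one.trans hL
  -- The exponent 13 is `7 + 6`, from `A ^ 9` and `A ^ 8`. The pivot case adds 6 from the cube of `A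
  -- ^ 4`, giving 19; the last case adds 3 from the cube of `A ^ 2`, giving 16.
  have hP : (64 ^ 3 * ((A ^ 9).card * (A ^ 8).card) : ℝ) ≤ 64 ^ 3 * (L ^ 13 * b ^ 2) := by
    refine mul_le_mul_of_nonneg_left ?_ (by norm_num)
    calc ((A ^ 9).card * (A ^ 8).card : ℝ) ≤ (L ^ 7 * b) * (L ^ 6 * b) :=
          mul_le_mul h9 h8 (Nat.cast_nonneg _) (by positivity)
      _ = _ := by ring
  have hL19 : L ^ 13 ≤ L ^ 19 := pow_le_pow_right₀ hL (by norm_num)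
  rcases growth_alternative h2 hsymm h1 hA hcard with h | h | h
  · left
    have h' : b ^ 6 ≤ 8 * ((A ^ 4).card : ℝ) ^ 3 * (64 ^ 3 * ((A ^ 9).card * (A ^ 8).card)) := by
      rw [hb]; exact_mod_cast h
    have h5 : b * b ^ 5 ≤ 2 ^ 21 * L ^ 19 * b ^ 5 := by
      calc b * b ^ 5 = b ^ 6 := by ring
        _ ≤ _ := h'
        _ ≤ 8 * (L ^ 2 * b) ^ 3 * (64 ^ 3 * (L ^ 13 * b ^ 2)) := by gcongr
        _ = _ := by ring
    have h6 := le_of_mul_le_mul_right h5 (by positivity)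
    refine h6.trans (mul_le_mul_of_nonneg_right (by norm_num) (by positivity))
  · left
    have h' : b ^ 3 ≤ 64 * (64 ^ 3 * ((A ^ 9).card * (A ^ 8).card)) := by
      rw [hb]; exact_mod_cast h
    have h5 : b * b ^ 2 ≤ 2 ^ 24 * L ^ 13 * b ^ 2 := by
      calc b * b ^ 2 = b ^ 3 := by ring
        _ ≤ _ := h'
        _ ≤ 64 * (64 ^ 3 * (L ^ 13 * b ^ 2)) := by gcongr
        _ = _ := by ring
    have h6 := le_of_mul_le_mul_right h5 (by positivity)
    refine h6.trans (mul_le_mul (by norm_num) hL19 (by positivity) (by positivity))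
  · right
    have hpp : 2 ≤ p := (Fact.out : p.Prime).two_le
    have hp0 : (0 : ℝ) < p := by exact_mod_cast (by omega : 0 < p)
    have hG : (p : ℝ) ^ 3 / 2 ≤ Fintype.card SL(2, ZMod p) := by
      have h5 : (((p - 1) * p ^ 2 : ℕ) : ℝ) ≤ Fintype.card SL(2, ZMod p) := by
        exact_mod_cast le_card_SL2 p
      rw [Nat.cast_mul, Nat.cast_sub (by omega), Nat.cast_pow, Nat.cast_one] at h5
      have h6 : (2 : ℝ) ≤ p := by exact_mod_cast hpp
      nlinarith [sq_nonneg (p : ℝ)]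
    have h' : ((Fintype.card SL(2, ZMod p) : ℝ) * b) ^ 3 ≤ (8 * p * (A ^ 2).card) ^ 3 *
        (64 ^ 3 * ((A ^ 9).card * (A ^ 8).card)) := by
      rw [hb]
      rw [ZMod.card] at h
      exact_mod_cast h
    have h5 : (p : ℝ) ^ 6 * (p ^ 3 * b ^ 3) ≤ 2 ^ 30 * L ^ 16 * b ^ 2 * (p ^ 3 * b ^ 3) := by
      calc (p : ℝ) ^ 6 * (p ^ 3 * b ^ 3) = 8 * (p ^ 3 / 2 * b) ^ 3 := by ring
        _ ≤ 8 * ((Fintype.card SL(2, ZMod p) : ℝ) * b) ^ 3 := by gcongr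
        _ ≤ 8 * ((8 * p * (A ^ 2).card) ^ 3 * (64 ^ 3 * ((A ^ 9).card * (A ^ 8).card))) := by
          gcongr
        _ ≤ 8 * ((8 * p * (L * b)) ^ 3 * (64 ^ 3 * (L ^ 13 * b ^ 2))) := by gcongr
        _ = _ := by ring
    exact le_of_mul_le_mul_right h5 (by positivity)

lemma card_le_of_pow_three_ne_univ {p : ℕ} [Fact p.Prime] {A : Finset SL(2, ZMod p)}
    (hsymm : A⁻¹ = A) (hA : Subgroup.closure (A : Set SL(2, ZMod p)) = ⊤) (hcard : 16 < A.card)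
    (hne : A ^ 3 ≠ Finset.univ) {K : ℝ} (hK : 1 ≤ K) (hK3 : ((A ^ 3).card : ℝ) ≤ K * A.card) :
    (A.card : ℝ) ≤ 2 ^ 77 * K ^ 19 := by
  set a : ℝ := (A.card : ℝ) with ha
  have ha1 : 1 ≤ a := by rw [ha]; exact_mod_cast (by omega : 1 ≤ A.card)
  have ha0 : 0 < a := by linarith
  have hK0 : 0 < K := by linarith
  have hpp : (2 : ℝ) ≤ p := by exact_mod_cast (Fact.out : p.Prime).two_le
  have hG : (Fintype.card SL(2, ZMod p) : ℝ) ≤ (p : ℝ) ^ 3 := by exact_mod_cast card_SL2_le p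
  have hq2 : ((A ^ 2).card : ℝ) ≤ K * a := by
    refine le_trans ?_ hK3
    exact_mod_cast Finset.card_pow_mono (s := A) (by norm_num) (by norm_num)
  have haG : a ≤ Fintype.card SL(2, ZMod p) := by rw [ha]; exact_mod_cast Finset.card_le_univ A
  have hph : (p : ℝ) / 2 ≤ p - 1 := by linarith
  rcases card_sq_le_or_card_le hsymm with h | h
  · have hap : a ≤ 16 * K * (p : ℝ) ^ 2 := by
      have h5 : a * (p * a) ≤ 16 * K * (p : ℝ) ^ 2 * (p * a) := by
        calc a * (p * a) = 2 * ((p : ℝ) / 2 * a ^ 2) := by ring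
          _ ≤ 2 * (((p : ℝ) - 1) * a ^ 2) := by gcongr
          _ ≤ 2 * (8 * ((A ^ 2).card * Fintype.card SL(2, ZMod p))) := by gcongr
          _ ≤ 2 * (8 * ((K * a) * (p : ℝ) ^ 3)) := by gcongr
          _ = _ := by ring
      exact le_of_mul_le_mul_right h5 (by positivity)
    have hne : A.Nonempty := Finset.card_pos.1 (by omega)
    -- The growth alternative needs the identity in the set; adjoining it costs at most a factor 4
    -- in the tripling constant.
    set B := insert 1 A with hB
    have hBsymm : B⁻¹ = B := by
      ext x
      rw [Finset.mem_inv', hB, Finset.mem_insert, Finset.mem_insert, inv_eq_one,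
        ← Finset.mem_inv', hsymm]
    have hBA : A ⊆ B := Finset.subset_insert 1 A
    have hBgen : Subgroup.closure (B : Set SL(2, ZMod p)) = ⊤ := by
      rw [eq_top_iff, ← hA]
      exact Subgroup.closure_mono (by exact_mod_cast hBA)
    have hABc : A.card ≤ B.card := Finset.card_le_card hBA
    have hab : a ≤ (B.card : ℝ) := by rw [ha]; exact_mod_cast hABc
    have hba : (B.card : ℝ) ≤ 2 * a := by
      have := Finset.card_insert_le 1 A
      rw [← hB] at this
      rw [ha]; exact_mod_cast (by omega : B.card ≤ 2 * A.card)
    have hB3 : ((B ^ 3).card : ℝ) ≤ 4 * K * B.card := by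
      have h5 : ((B ^ 3).card : ℝ) ≤ 4 * (A ^ 3).card := by
        exact_mod_cast card_insert_one_pow_three_le hne
      calc ((B ^ 3).card : ℝ) ≤ 4 * (K * a) := by linarith
        _ = 4 * K * a := by ring
        _ ≤ _ := by gcongr
    rcases card_le_or_pow_six_le hBsymm (Finset.mem_insert_self 1 A) hBgen (by omega)
      (by linarith) hB3 with h6 | h6
    · calc a ≤ 2 ^ 39 * (4 * K) ^ 19 := hab.trans h6
        _ = _ := by ring
    -- The upper bound `a ≤ 16 * K * p ^ 2` is cubed to meet the bound for `p ^ 6`; the exponent of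
    -- `K` is `3 + 16`.
    · have h7 : a * a ^ 2 ≤ 2 ^ 76 * K ^ 19 * a ^ 2 := by
        calc a * a ^ 2 = a ^ 3 := by ring
          _ ≤ (16 * K * (p : ℝ) ^ 2) ^ 3 := by gcongr
          _ = 2 ^ 12 * K ^ 3 * (p : ℝ) ^ 6 := by ring
          _ ≤ 2 ^ 12 * K ^ 3 * (2 ^ 30 * (4 * K) ^ 16 * (B.card : ℝ) ^ 2) := by gcongr
          _ ≤ 2 ^ 12 * K ^ 3 * (2 ^ 30 * (4 * K) ^ 16 * (2 * a) ^ 2) := by gcongr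
          _ = _ := by ring
      have h8 := le_of_mul_le_mul_right h7 (by positivity)
      exact h8.trans (mul_le_mul_of_nonneg_right (by norm_num) (by positivity))
  · have h5 := card_cube_le_of_pow_three_ne_univ hsymm hne
    have hp32 : (p : ℝ) ≤ 32 * K ^ 3 := by
      have h6 : (p : ℝ) * a ^ 3 ≤ 32 * K ^ 3 * a ^ 3 := by
        calc (p : ℝ) * a ^ 3 = 2 * ((p : ℝ) / 2 * a ^ 3) := by ring
          _ ≤ 2 * (((p : ℝ) - 1) * a ^ 3) := by gcongr
          _ ≤ 2 * (2 * (Fintype.card SL(2, ZMod p) : ℝ) ^ 3) := by gcongr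
          _ ≤ 2 * (2 * (2 * (K * a)) ^ 3) := by
            gcongr
            linarith
          _ = _ := by ring
      exact le_of_mul_le_mul_right h6 (by positivity)
    calc a ≤ (p : ℝ) ^ 3 := haG.trans hG
      _ ≤ (32 * K ^ 3) ^ 3 := by gcongr
      _ = 2 ^ 15 * K ^ 9 := by ring
      _ ≤ 2 ^ 77 * K ^ 19 := mul_le_mul (by norm_num) (pow_le_pow_right₀ hK (by norm_num))
          (by positivity) (by positivity)

end Growth

theorem theorem2 :
    ∃ (N : ℕ) (c : ℝ), 0 < c ∧
      ∀ (p : ℕ) [Fact p.Prime] (A : Finset SL(2, ZMod p)) (K : ℝ),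
        A⁻¹ = A →
        Subgroup.closure (A : Set SL(2, ZMod p)) = ⊤ →
        ((A ^ 3).card : ℝ) = K * (A.card : ℝ) →
        N < A.card →
        A ^ 3 = Finset.univ ∨ c * (A.card : ℝ) ^ (1 / 20 : ℝ) ≤ K := by
  -- The 16 comes from `exists_regular`. The bound obtained has `K ^ 19`, weakened to `K ^ 20` using
  -- `1 ≤ K` before the twentieth root is taken.
  refine ⟨16, ((2 : ℝ) ^ 77)⁻¹ ^ (1 / 20 : ℝ), by positivity, ?_⟩
  intro p _ A K hsymm hA hK hcard
  by_cases hne : A ^ 3 = Finset.univ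
  · exact Or.inl hne
  right
  have ha0 : (0 : ℝ) < A.card := by exact_mod_cast (by omega : 0 < A.card)
  have hK1 : 1 ≤ K := by
    have h1 : (A.card : ℝ) ≤ K * A.card := by
      rw [← hK]
      have := Finset.card_pow_mono (s := A) (m := 1) (n := 3) (by norm_num) (by norm_num)
      rw [pow_one] at this
      exact_mod_cast this
    exact le_of_mul_le_mul_right (by linarith) ha0
  have h := card_le_of_pow_three_ne_univ hsymm hA hcard hne hK1 hK.le
  have h20 : ((2 : ℝ) ^ 77)⁻¹ * A.card ≤ K ^ 20 := by
    rw [inv_mul_le_iff₀ (by positivity)]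
    exact h.trans (mul_le_mul_of_nonneg_left (pow_le_pow_right₀ hK1 (by norm_num))
      (by positivity))
  rw [← Real.mul_rpow (by positivity) ha0.le]
  calc (((2 : ℝ) ^ 77)⁻¹ * A.card) ^ (1 / 20 : ℝ) ≤ (K ^ 20) ^ (1 / 20 : ℝ) :=
        Real.rpow_le_rpow (by positivity) h20 (by norm_num)
    _ = K := by
        rw [← Real.rpow_natCast, ← Real.rpow_mul (by linarith)]
        norm_num
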